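/- Let $M$ be a smooth $n$-dimensional (Hausdorff) manifold with a smooth torsion-free affine connection $\nabla$ with curvature tensor $R^\nabla$, and for $X\in T_pM$ let $S^\nabla(X):T_pM\to T_pM$, $S^\nabla(X)Y=(\nabla_X R^\nabla)(Y,X)X$, be the affine Szabó operator. Let $g_\nabla$ be the Riemannian extension of $\nabla$ to the cotangent bundle $\pi:T^*M\to M$, i.e. the pseudo-Riemannian metric which in the coordinates $(u_1,\dots,u_n,u_{1'},\dots,u_{n'})$ of $T^*M$ induced by local coordinates $(u_1,\dots,u_n)$ of $M$ has the matrix $$g_\nabla=\begin{pmatrix}-2\sum_k u_{k'}\Gamma^k_{ij} & \delta_i^j\\ \delta_i^j & 0\end{pmatrix},$$ where $\Gamma_{ij}^k$ are the Christoffel symbols of $\nabla$. For $\tilde X\in T_\xi(T^*M)$ let $\tilde S(\tilde X)\tilde Y=(\tilde\nabla_{\tilde X}\tilde R)(\tilde Y,\tilde X)\tilde X$ be the Szabó operator of $g_\nabla$, where $\tilde\nabla$ and $\tilde R$ are the Levi-Civita connection of $g_\nabla$ and its curvature tensor. Then for every $\xi\in T^*M$ and every $\tilde X\in T_\xi(T^*M)$,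 with $X=d\pi_\xi(\tilde X)\in T_{\pi(\xi)}M$, $$\mathrm{Spect}\{\tilde S(\tilde X)\}=\mathrm{Spect}\{S^\nabla(X)\}$$ as sets of eigenvalues. This holds both for the real eigenvalues and for the complex eigenvalues (the eigenvalues of the complexified operators). -/

import Mathlib

open Bundle
open scoped Manifold ContDiff

noncomputable section

namespace SzaboExtension

section Local

variable {F : Type*} [NormedAddCommGroup F] [NormedSpace ℝ F]

/-- The curvature tensor, on a coordinate domain in `F`, of the connection with Christoffel
symbols `Γ` (`Γ y u v` is `∇_u v` at `y` for constant vector fields `u`, `v`), as the linear map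
`u ↦ R(u,v)w`, where
`R(u,v)w = ∂_u Γ(v,w) - ∂_v Γ(u,w) + Γ(u,Γ(v,w)) - Γ(v,Γ(u,w))`. -/
def localCurvature (Γ : F → F →L[ℝ] F →L[ℝ] F) (y v w : F) : F →L[ℝ] F :=
  fderiv ℝ (fun z ↦ Γ z v w) y - fderiv ℝ (fun z ↦ (Γ z).flip w) y v
    + (Γ y).flip (Γ y v w) - (Γ y v).comp ((Γ y).flip w)

theorem localCurvature_apply (Γ : F → F →L[ℝ] F →L[ℝ] F) (y u v w : F) :
    localCurvature Γ y v w u =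
      fderiv ℝ (fun z ↦ Γ z v w) y u - fderiv ℝ (fun z ↦ (Γ z).flip w) y v u
        + Γ y u (Γ y v w) - Γ y v (Γ y u w) := rfl

/-- The covariant derivative of the curvature tensor, in coordinates, as the linear map
`u ↦ (∇_x R)(u,v)w`, where
`(∇_x R)(u,v)w = ∂_x (R(u,v)w) + Γ(x,R(u,v)w) - R(Γ(x,u),v)w - R(u,Γ(x,v))w - R(u,v)Γ(x,w)`
for constant vector fields `u`, `v`, `w`. -/
def localCurvatureDeriv (Γ : F → F →L[ℝ] F →L[ℝ] F) (y x v w : F) : F →L[ℝ] F :=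
  fderiv ℝ (fun z ↦ localCurvature Γ z v w) y x + (Γ y x).comp (localCurvature Γ y v w)
    - (localCurvature Γ y v w).comp (Γ y x) - localCurvature Γ y (Γ y x v) w
    - localCurvature Γ y v (Γ y x w)

/-- The Szabó operator `S(X) : Y ↦ (∇_X R)(Y,X)X`, in coordinates. -/
def localSzabo (Γ : F → F →L[ℝ] F →L[ℝ] F) (y X : F) : F →L[ℝ] F :=
  localCurvatureDeriv Γ y X X X

/-- The Christoffel symbols of the first kind of a metric `G` given in coordinates:
`z ↦ ½ (∂_u G(v,z) + ∂_v G(u,z) - ∂_z G(u,v))`. -/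
def localChristoffelFirst (G : F → F →L[ℝ] F →L[ℝ] ℝ) (y u v : F) : F →L[ℝ] ℝ :=
  (1 / 2 : ℝ) • (fderiv ℝ G y u v + fderiv ℝ G y v u - ((fderiv ℝ G y).flip u).flip v)

theorem localChristoffelFirst_apply (G : F → F →L[ℝ] F →L[ℝ] ℝ) (y u v z : F) :
    localChristoffelFirst G y u v z =
      (1 / 2 : ℝ) * (fderiv ℝ G y u v z + fderiv ℝ G y v u z - fderiv ℝ G y z u v) := rfl

theorem localChristoffelFirst_add_left (G : F → F →L[ℝ] F →L[ℝ] ℝ) (y u u' v : F) :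
    localChristoffelFirst G y (u + u') v =
      localChristoffelFirst G y u v + localChristoffelFirst G y u' v := by
  ext z
  have h1 : fderiv ℝ G y (u + u') v z = fderiv ℝ G y u v z + fderiv ℝ G y u' v z := by
    rw [(fderiv ℝ G y).map_add]; rfl
  have h2 : fderiv ℝ G y v (u + u') z = fderiv ℝ G y v u z + fderiv ℝ G y v u' z := by
    rw [(fderiv ℝ G y v).map_add]; rfl
  have h3 : fderiv ℝ G y z (u + u') v = fderiv ℝ G y z u v + fderiv ℝ G y z u' v := by
    rw [(fderiv ℝ G y z).map_add]; rfl
  rw [add_apply, localChristoffelFirst_apply, localChristoffelFirst_apply,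
    localChristoffelFirst_apply, h1, h2, h3]
  ring

theorem localChristoffelFirst_smul_left (G : F → F →L[ℝ] F →L[ℝ] ℝ) (y : F) (c : ℝ) (u v : F) :
    localChristoffelFirst G y (c • u) v = c • localChristoffelFirst G y u v := by
  ext z
  have h1 : fderiv ℝ G y (c • u) v z = c * fderiv ℝ G y u v z := by
    rw [(fderiv ℝ G y).map_smul]; rfl
  have h2 : fderiv ℝ G y v (c • u) z = c * fderiv ℝ G y v u z := by
    rw [(fderiv ℝ G y v).map_smul]; rfl
  have h3 : fderiv ℝ G y z (c • u) v = c * fderiv ℝ G y z u v := by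
    rw [(fderiv ℝ G y z).map_smul]; rfl
  rw [smul_apply, localChristoffelFirst_apply, localChristoffelFirst_apply, h1, h2, h3,
    smul_eq_mul]
  ring

theorem localChristoffelFirst_add_right (G : F → F →L[ℝ] F →L[ℝ] ℝ) (y u v v' : F) :
    localChristoffelFirst G y u (v + v') =
      localChristoffelFirst G y u v + localChristoffelFirst G y u v' := by
  ext z
  have h1 : fderiv ℝ G y (v + v') u z = fderiv ℝ G y v u z + fderiv ℝ G y v' u z := by
    rw [(fderiv ℝ G y).map_add]; rfl
  have h2 : fderiv ℝ G y u (v + v') z = fderiv ℝ G y u v z + fderiv ℝ G y u v' z := by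
    rw [(fderiv ℝ G y u).map_add]; rfl
  have h3 : fderiv ℝ G y z u (v + v') = fderiv ℝ G y z u v + fderiv ℝ G y z u v' := by
    rw [(fderiv ℝ G y z u).map_add]
  rw [add_apply, localChristoffelFirst_apply, localChristoffelFirst_apply,
    localChristoffelFirst_apply, h1, h2, h3]
  ring

theorem localChristoffelFirst_smul_right (G : F → F →L[ℝ] F →L[ℝ] ℝ) (y : F) (c : ℝ) (u v : F) :
    localChristoffelFirst G y u (c • v) = c • localChristoffelFirst G y u v := by
  ext z
  have h1 : fderiv ℝ G y (c • v) u z = c * fderiv ℝ G y v u z := by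
    rw [(fderiv ℝ G y).map_smul]; rfl
  have h2 : fderiv ℝ G y u (c • v) z = c * fderiv ℝ G y u v z := by
    rw [(fderiv ℝ G y u).map_smul]; rfl
  have h3 : fderiv ℝ G y z u (c • v) = c * fderiv ℝ G y z u v := by
    rw [(fderiv ℝ G y z u).map_smul]; rfl
  rw [smul_apply, localChristoffelFirst_apply, localChristoffelFirst_apply, h1, h2, h3,
    smul_eq_mul]
  ring

/-- The Christoffel symbols of the Levi-Civita connection of a (pseudo-Riemannian) metric `G`
given in coordinates: `Γ(u,v)` is the vector `w` with
`G(w,z) = ½ (∂_u G(v,z) + ∂_v G(u,z) - ∂_z G(u,v))` for all `z`. -/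
def localLeviCivita [FiniteDimensional ℝ F] (G : F → F →L[ℝ] F →L[ℝ] ℝ) (y : F) :
    F →L[ℝ] F →L[ℝ] F :=
  (LinearMap.mk₂ ℝ
    (fun u v ↦ ContinuousLinearMap.inverse (G y) (localChristoffelFirst G y u v))
    (fun u u' v ↦ by rw [← map_add, localChristoffelFirst_add_left])
    (fun c u v ↦ by rw [← map_smul, localChristoffelFirst_smul_left])
    (fun u v v' ↦ by rw [← map_add, localChristoffelFirst_add_right])
    (fun c u v ↦ by rw [← map_smul, localChristoffelFirst_smul_right])).toContinuousBilinearMap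

theorem localLeviCivita_apply [FiniteDimensional ℝ F] (G : F → F →L[ℝ] F →L[ℝ] ℝ) (y u v : F) :
    localLeviCivita G y u v =
      ContinuousLinearMap.inverse (G y) (localChristoffelFirst G y u v) := rfl

end Local

section Metric

variable {F : Type*} [NormedAddCommGroup F] [NormedSpace ℝ F]
  {H : Type*} [TopologicalSpace H] {I : ModelWithCorners ℝ F H}
  {N : Type*} [TopologicalSpace N] [ChartedSpace H N] [IsManifold I 1 N]

/-- The components of a field of bilinear forms on the tangent spaces of `N` in the chart of `N`
at the point `p`. -/
def metricInChart (g : ∀ q : N, TangentSpace I q →L[ℝ] TangentSpace I q →L[ℝ] ℝ) (p : N)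
    (y : F) : F →L[ℝ] F →L[ℝ] ℝ :=
  (ContinuousLinearMap.precomp ℝ
      ((trivializationAt F (TangentSpace I) p).symmL ℝ ((extChartAt I p).symm y))).comp
    ((g ((extChartAt I p).symm y)).comp
      ((trivializationAt F (TangentSpace I) p).symmL ℝ ((extChartAt I p).symm y)))

theorem metricInChart_apply (g : ∀ q : N, TangentSpace I q →L[ℝ] TangentSpace I q →L[ℝ] ℝ)
    (p : N) (y u v : F) :
    metricInChart g p y u v =
      g ((extChartAt I p).symm y)
        ((trivializationAt F (TangentSpace I) p).symmL ℝ ((extChartAt I p).symm y) u)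
        ((trivializationAt F (TangentSpace I) p).symmL ℝ ((extChartAt I p).symm y) v) := rfl

variable [FiniteDimensional ℝ F]

/-- The Szabó operator at `X ∈ T_pN` of the Levi-Civita connection of the pseudo-Riemannian
metric `g` on `N`. It is computed in the chart at `p`, whose differential at `p` is the identity
`T_pN = F`. -/
def metricSzabo (g : ∀ q : N, TangentSpace I q →L[ℝ] TangentSpace I q →L[ℝ] ℝ) (p : N)
    (X : TangentSpace I p) : TangentSpace I p →ₗ[ℝ] TangentSpace I p :=
  (localSzabo (F := F) (localLeviCivita (metricInChart g p)) (extChartAt I p p) X).toLinearMap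

end Metric

section Affine

variable {E : Type*} [NormedAddCommGroup E] [NormedSpace ℝ E]
  {M : Type*} [TopologicalSpace M] [ChartedSpace E M] [IsManifold 𝓘(ℝ, E) ∞ M]

/-- The coordinate vector field of the chart at `p` with constant components `v`. -/
def coordField (p : M) (v : E) (q : M) : TangentSpace 𝓘(ℝ, E) q :=
  (trivializationAt E (TangentSpace 𝓘(ℝ, E) : M → Type _) p).symmL ℝ q v

theorem mdifferentiableAt_coordField (p : M) (v : E) {q : M}
    (hq : q ∈ (trivializationAt E (TangentSpace 𝓘(ℝ, E) : M → Type _) p).baseSet) :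
    MDiffAt (T% (coordField p v)) q := by
  rw [(trivializationAt E (TangentSpace 𝓘(ℝ, E) : M → Type _) p).mdifferentiableAt_section_iff
    _ _ hq]
  refine (mdifferentiableAt_const (c := v)).congr_of_eventuallyEq ?_
  filter_upwards [(trivializationAt E (TangentSpace 𝓘(ℝ, E) : M → Type _) p).open_baseSet.mem_nhds
    hq] with x hx
  rw [coordField, Trivialization.symmL_apply _ hx, Trivialization.apply_mk_symm _ hx]

theorem coordField_add (p : M) (v w : E) :
    coordField p (v + w) = (coordField p v + coordField p w : Π q : M, TangentSpace 𝓘(ℝ, E) q) := by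
  funext q
  simp [coordField]

theorem coordField_smul (p : M) (c : ℝ) (v : E) :
    coordField p (c • v) = (c • coordField p v : Π q : M, TangentSpace 𝓘(ℝ, E) q) := by
  funext q
  simp [coordField]

theorem symmL_eq_zero (p : M) {q : M}
    (hq : q ∉ (trivializationAt E (TangentSpace 𝓘(ℝ, E) : M → Type _) p).baseSet) :
    (trivializationAt E (TangentSpace 𝓘(ℝ, E) : M → Type _) p).symmL ℝ q = 0 :=
  ContinuousLinearMap.ext fun v ↦ Trivialization.symmL_apply_of_notMem _ hq v

variable [FiniteDimensional ℝ E]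

/-- The Christoffel symbols, in the chart at `p`, of a connection on the tangent bundle:
for `y` in the target of the chart, `christoffel cov p y u v` is the coordinate expression, at the
point with coordinates `y`, of the derivative in the direction `u` of the coordinate field `v`. -/
def christoffel (cov : CovariantDerivative 𝓘(ℝ, E) E (TangentSpace 𝓘(ℝ, E) : M → Type _))
    (p : M) (y : E) : E →L[ℝ] E →L[ℝ] E :=
  (LinearMap.toContinuousLinearMap
    { toFun := fun v : E ↦
        ((trivializationAt E (TangentSpace 𝓘(ℝ, E) : M → Type _) p).continuousLinearMapAt ℝ
          ((extChartAt 𝓘(ℝ, E) p).symm y)).comp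
        ((cov (coordField p v) ((extChartAt 𝓘(ℝ, E) p).symm y)).comp
          ((trivializationAt E (TangentSpace 𝓘(ℝ, E) : M → Type _) p).symmL ℝ
            ((extChartAt 𝓘(ℝ, E) p).symm y)))
      map_add' := fun v w ↦ by
        by_cases hq : (extChartAt 𝓘(ℝ, E) p).symm y ∈
            (trivializationAt E (TangentSpace 𝓘(ℝ, E) : M → Type _) p).baseSet
        · rw [coordField_add, cov.isCovariantDerivativeOnUniv.add
            (mdifferentiableAt_coordField p v hq) (mdifferentiableAt_coordField p w hq)]
          rw [ContinuousLinearMap.add_comp, ContinuousLinearMap.comp_add]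
        · rw [symmL_eq_zero p hq]
          simp only [ContinuousLinearMap.comp_zero, add_zero]
      map_smul' := fun c v ↦ by
        by_cases hq : (extChartAt 𝓘(ℝ, E) p).symm y ∈
            (trivializationAt E (TangentSpace 𝓘(ℝ, E) : M → Type _) p).baseSet
        · rw [coordField_smul, cov.isCovariantDerivativeOnUniv.smul_const c
            (mdifferentiableAt_coordField p v hq)]
          rw [ContinuousLinearMap.smul_comp, ContinuousLinearMap.comp_smul, RingHom.id_apply]
        · rw [symmL_eq_zero p hq]
          simp only [ContinuousLinearMap.comp_zero, smul_zero] } : E →L[ℝ] E →L[ℝ] E).flip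

theorem christoffel_apply
    (cov : CovariantDerivative 𝓘(ℝ, E) E (TangentSpace 𝓘(ℝ, E) : M → Type _))
    (p : M) (y u v : E) :
    christoffel cov p y u v =
      (trivializationAt E (TangentSpace 𝓘(ℝ, E) : M → Type _) p).continuousLinearMapAt ℝ
        ((extChartAt 𝓘(ℝ, E) p).symm y)
        (cov (coordField p v) ((extChartAt 𝓘(ℝ, E) p).symm y)
          (coordField p u ((extChartAt 𝓘(ℝ, E) p).symm y))) := rfl

/-- The affine Szabó operator `Y ↦ (∇_X R)(Y,X)X` at `X ∈ T_pM` of a connection on the tangent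
bundle. It is computed in the chart at `p`, whose differential at `p` is the identity
`T_pM = E`. -/
def affineSzabo (cov : CovariantDerivative 𝓘(ℝ, E) E (TangentSpace 𝓘(ℝ, E) : M → Type _))
    (p : M) (X : TangentSpace 𝓘(ℝ, E) p) :
    TangentSpace 𝓘(ℝ, E) p →ₗ[ℝ] TangentSpace 𝓘(ℝ, E) p :=
  (localSzabo (F := E) (christoffel cov p) (extChartAt 𝓘(ℝ, E) p p) X).toLinearMap

end Affine

section Cotangent

variable (E : Type*) [NormedAddCommGroup E] [NormedSpace ℝ E]
  (M : Type*) [TopologicalSpace M] [ChartedSpace E M] [IsManifold 𝓘(ℝ, E) ∞ M]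

/-- The total space `T*M` of the cotangent bundle of `M`. -/
abbrev Cotangent : Type _ :=
  TotalSpace (E →L[ℝ] ℝ) (fun p : M ↦ TangentSpace 𝓘(ℝ, E) p →L[ℝ] Trivial M ℝ p)

/-- The model of `T*M`. The chart of `T*M` at `ζ` is the induced chart `(u_i, u_{i'})` obtained
from the chart of `M` at the base point of `ζ`. -/
abbrev cotangentModel : ModelWithCorners ℝ (E × (E →L[ℝ] ℝ)) (ModelProd E (E →L[ℝ] ℝ)) :=
  𝓘(ℝ, E).prod 𝓘(ℝ, E →L[ℝ] ℝ)

variable {E M} [FiniteDimensional ℝ E]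

/-- The bilinear form `((u,a),(v,b)) ↦ a(v) + b(u) - 2 ζ(Γ(u,v))` on `E × E*`. -/
def riemannExtForm (Γ : E →L[ℝ] E →L[ℝ] E) (ζ : E →L[ℝ] ℝ) :
    (E × (E →L[ℝ] ℝ)) →L[ℝ] (E × (E →L[ℝ] ℝ)) →L[ℝ] ℝ :=
  (LinearMap.mk₂ ℝ
    (fun X Y : E × (E →L[ℝ] ℝ) ↦ X.2 Y.1 + Y.2 X.1 - 2 * ζ (Γ X.1 Y.1))
    (fun X X' Y ↦ by
      simp only [Prod.fst_add, Prod.snd_add, map_add, add_apply]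
      ring)
    (fun c X Y ↦ by
      simp only [Prod.smul_fst, Prod.smul_snd, map_smul, smul_apply, smul_eq_mul]
      ring)
    (fun X Y Y' ↦ by
      simp only [Prod.fst_add, Prod.snd_add, map_add, add_apply]
      ring)
    (fun c X Y ↦ by
      simp only [Prod.smul_fst, Prod.smul_snd, map_smul, smul_apply, smul_eq_mul]
      ring)).toContinuousBilinearMap

theorem riemannExtForm_apply (Γ : E →L[ℝ] E →L[ℝ] E) (ζ a b : E →L[ℝ] ℝ) (u v : E) :
    riemannExtForm Γ ζ (u, a) (v, b) = a v + b u - 2 * ζ (Γ u v) := rfl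

/-- The Riemannian extension `g_∇` on `T*M`. At `ζ ∈ T_p*M` it has, in the induced coordinates
around `ζ`, the matrix with blocks `-2 u_{k'} Γ^k_{ij}`, `δ`, `δ`, `0`. -/
def riemannExt (cov : CovariantDerivative 𝓘(ℝ, E) E (TangentSpace 𝓘(ℝ, E) : M → Type _))
    (ζ : Cotangent E M) :
    TangentSpace (cotangentModel E) ζ →L[ℝ] TangentSpace (cotangentModel E) ζ →L[ℝ] ℝ :=
  riemannExtForm (E := E) (christoffel cov ζ.proj (extChartAt 𝓘(ℝ, E) ζ.proj ζ.proj)) ζ.snd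

end Cotangent

end SzaboExtension

end

noncomputable section

namespace SzaboExtension

open Filter Topology

set_option maxSynthPendingDepth 3

/-! ### Smoothness and locality of curvature, Szabó operator and Levi-Civita symbols -/

section LocalCalculus

variable {F : Type*} [NormedAddCommGroup F] [NormedSpace ℝ F]

/-! In induced coordinates on `E × E*` the Levi-Civita connection of the Riemannian extension covers
`∇`: the base component of its Christoffel symbols is `Γ`. Curvature, its covariant derivative and
the Szabó operator therefore project to those of `∇` (`fst_localSzabo_extensionMetric`). The
vertical distribution is parallel, and on a vertical vector `(0, b)` the Szabó operator acts by `b ↦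
b ∘ S(X)` (`localSzabo_extensionMetric_vertical`). So the Szabó operator upstairs is block
triangular with diagonal blocks `S(X)` and its transpose; the remaining block is never computed. Its
characteristic polynomial is the square of that of `S(X)` (`charpoly_eq_sq_of_transpose`), which
gives equal real spectra and, after base change, equal complex spectra.

The passage to the manifold rests on `metricInChart_riemannExt`. The metric is prescribed at each
covector in the chart centred there, whereas differentiation needs a single chart on a
neighbourhood. The two descriptions agree because the inhomogeneous term in the transformation law
of `Γ` cancels the derivative terms in the change of fibre coordinates. Vanishing torsion enters as
symmetry of `Γ`, both in this cancellation and in the curvature of vertical vectors. -/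

theorem fderiv_clm_apply_const {D G H : Type*} [NormedAddCommGroup D] [NormedSpace ℝ D]
    [NormedAddCommGroup G] [NormedSpace ℝ G] [NormedAddCommGroup H] [NormedSpace ℝ H]
    {f : D → G →L[ℝ] H} {y : D} (hf : DifferentiableAt ℝ f y) (v : G) (w : D) :
    fderiv ℝ (fun z ↦ f z v) y w = fderiv ℝ f y w v := by
  rw [(hf.hasFDerivAt.clm_apply (hasFDerivAt_const v y)).fderiv]
  simp

theorem fderiv_clm_apply_apply_const {D G G' H : Type*} [NormedAddCommGroup D] [NormedSpace ℝ D]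
    [NormedAddCommGroup G] [NormedSpace ℝ G] [NormedAddCommGroup H] [NormedSpace ℝ H]
    [NormedAddCommGroup G'] [NormedSpace ℝ G']
    {f : D → G →L[ℝ] G' →L[ℝ] H} {y : D} (hf : DifferentiableAt ℝ f y) (v : G) (v' : G') (w : D) :
    fderiv ℝ (fun z ↦ f z v v') y w = fderiv ℝ f y w v v' := by
  rw [fderiv_clm_apply_const (f := fun z ↦ f z v) (by fun_prop), fderiv_clm_apply_const hf]

theorem fderiv_flip_apply {D G G' H : Type*} [NormedAddCommGroup D] [NormedSpace ℝ D]
    [NormedAddCommGroup G] [NormedSpace ℝ G] [NormedAddCommGroup H] [NormedSpace ℝ H]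
    [NormedAddCommGroup G'] [NormedSpace ℝ G']
    {f : D → G →L[ℝ] G' →L[ℝ] H} {y : D} (hf : DifferentiableAt ℝ f y) (v : G) (v' : G') (w : D) :
    fderiv ℝ (fun z ↦ (f z).flip v') y w v = fderiv ℝ f y w v v' := by
  have h : DifferentiableAt ℝ (fun z ↦ (f z).flip v') y := by
    have := (ContinuousLinearMap.flipₗᵢ ℝ G G' H).toContinuousLinearEquiv.toContinuousLinearMap
      |>.differentiableAt.comp y hf
    exact this.clm_apply (differentiableAt_const v')
  rw [← fderiv_clm_apply_const h]
  exact fderiv_clm_apply_apply_const hf v v' w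

/-- A basis of `G` identifies `G →L[ℝ] H` with a finite power of `H`, so smoothness can be tested on
fixed vectors. -/
theorem contDiffAt_clm_apply_iff {D G H : Type*} [NormedAddCommGroup D] [NormedSpace ℝ D]
    [NormedAddCommGroup G] [NormedSpace ℝ G] [NormedAddCommGroup H] [NormedSpace ℝ H]
    [FiniteDimensional ℝ G] {f : D → G →L[ℝ] H} {y : D} {n : WithTop ℕ∞} :
    ContDiffAt ℝ n f y ↔ ∀ v, ContDiffAt ℝ n (fun z ↦ f z v) y := by
  refine ⟨fun h v ↦ h.clm_apply contDiffAt_const, fun h ↦ ?_⟩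
  let d := Module.finrank ℝ G
  have hd : d = Module.finrank ℝ (Fin d → ℝ) := (Module.finrank_fin_fun ℝ).symm
  let e₁ := ContinuousLinearEquiv.ofFinrankEq hd
  let e₂ := (e₁.arrowCongr (1 : H ≃L[ℝ] H)).trans (ContinuousLinearEquiv.piRing (Fin d))
  rw [← Function.id_comp f, ← e₂.symm_comp_self]
  exact e₂.symm.contDiff.contDiffAt.comp y (contDiffAt_pi.mpr fun i ↦ h _)

/-- The curvature in terms of the derivative of the Christoffel symbols. -/
theorem localCurvature_eq_fderiv {Γ : F → F →L[ℝ] F →L[ℝ] F} {y : F}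
    (hΓ : DifferentiableAt ℝ Γ y) (u v w : F) :
    localCurvature Γ y v w u =
      fderiv ℝ Γ y u v w - fderiv ℝ Γ y v u w + Γ y u (Γ y v w) - Γ y v (Γ y u w) := by
  rw [localCurvature_apply, fderiv_clm_apply_apply_const hΓ, fderiv_flip_apply hΓ]

theorem contDiffAt_localCurvature {Γ : F → F →L[ℝ] F →L[ℝ] F} {y : F}
    [FiniteDimensional ℝ F] (hΓ : ContDiffAt ℝ ∞ Γ y) (v w : F) :
    ContDiffAt ℝ ∞ (fun z ↦ localCurvature Γ z v w) y := by
  rw [contDiffAt_clm_apply_iff]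
  intro u
  have h : ∀ᶠ z in 𝓝 y, DifferentiableAt ℝ Γ z := by
    filter_upwards [(hΓ.of_le (m := 1) (by simp)).eventually (by simp)] with z hz
    exact hz.differentiableAt (by simp)
  have hD : ContDiffAt ℝ ∞ (fderiv ℝ Γ) y := hΓ.fderiv_right (by simp)
  have := ((((hD.clm_apply (contDiffAt_const (c := u))).clm_apply
    (contDiffAt_const (c := v))).clm_apply (contDiffAt_const (c := w))).sub
    (((hD.clm_apply (contDiffAt_const (c := v))).clm_apply
    (contDiffAt_const (c := u))).clm_apply (contDiffAt_const (c := w)))).add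
    ((hΓ.clm_apply (contDiffAt_const (c := u))).clm_apply
      ((hΓ.clm_apply (contDiffAt_const (c := v))).clm_apply (contDiffAt_const (c := w)))) |>.sub
    ((hΓ.clm_apply (contDiffAt_const (c := v))).clm_apply
      ((hΓ.clm_apply (contDiffAt_const (c := u))).clm_apply (contDiffAt_const (c := w))))
  exact this.congr_of_eventuallyEq (h.mono fun z hz ↦ localCurvature_eq_fderiv hz u v w)

theorem localCurvature_congr {Γ Γ' : F → F →L[ℝ] F →L[ℝ] F} {y : F}
    (h : Γ =ᶠ[𝓝 y] Γ') (v w : F) :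
    localCurvature Γ y v w = localCurvature Γ' y v w := by
  have h1 : (fun z ↦ Γ z v w) =ᶠ[𝓝 y] fun z ↦ Γ' z v w := h.mono fun z hz ↦ by simp only [hz]
  have h2 : (fun z ↦ (Γ z).flip w) =ᶠ[𝓝 y] fun z ↦ (Γ' z).flip w :=
    h.mono fun z hz ↦ by simp only [hz]
  simp only [localCurvature, h1.fderiv_eq, h2.fderiv_eq, h.eq_of_nhds]

/-- Only the germ of `Γ` matters, which later allows the metric in a chart to be replaced by an
explicit formula valid near one point. -/
theorem localSzabo_congr {Γ Γ' : F → F →L[ℝ] F →L[ℝ] F} {y : F}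
    (h : Γ =ᶠ[𝓝 y] Γ') (X : F) : localSzabo Γ y X = localSzabo Γ' y X := by
  have h1 : (fun z ↦ localCurvature Γ z X X) =ᶠ[𝓝 y]
      fun z ↦ localCurvature Γ' z X X :=
    h.eventuallyEq_nhds.mono fun z hz ↦ localCurvature_congr hz X X
  simp only [localSzabo, localCurvatureDeriv, h1.fderiv_eq, localCurvature_congr h,
    h.eq_of_nhds]

theorem localLeviCivita_congr [FiniteDimensional ℝ F]
    {G G' : F → F →L[ℝ] F →L[ℝ] ℝ} {y : F} (h : G =ᶠ[𝓝 y] G') :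
    localLeviCivita G y = localLeviCivita G' y := by
  ext u v
  simp only [localLeviCivita_apply, localChristoffelFirst, h.fderiv_eq, h.eq_of_nhds]

/-- Inversion of operators is smooth at an invertible one; the symbols of the first kind are
polynomial in the derivative of `G`. -/
theorem contDiffAt_localLeviCivita [FiniteDimensional ℝ F]
    {G : F → F →L[ℝ] F →L[ℝ] ℝ} {y : F} (hG : ContDiffAt ℝ ∞ G y) (hi : (G y).IsInvertible) :
    ContDiffAt ℝ ∞ (localLeviCivita G) y := by
  rw [contDiffAt_clm_apply_iff]
  intro u
  rw [contDiffAt_clm_apply_iff]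
  intro v
  simp only [localLeviCivita_apply]
  obtain ⟨e, he⟩ := hi
  have h1 : ContDiffAt ℝ ∞ (fun z ↦ ContinuousLinearMap.inverse (G z)) y := by
    refine ContDiffAt.comp y (g := ContinuousLinearMap.inverse) ?_ hG
    rw [← he]
    exact contDiffAt_map_inverse e
  refine h1.clm_apply ?_
  rw [contDiffAt_clm_apply_iff]
  intro z
  simp only [localChristoffelFirst_apply]
  have hD : ContDiffAt ℝ ∞ (fderiv ℝ G) y := hG.fderiv_right (by simp)
  have h (a b c : F) : ContDiffAt ℝ ∞ (fun z ↦ fderiv ℝ G z a b c) y :=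
    ((hD.clm_apply contDiffAt_const).clm_apply contDiffAt_const).clm_apply contDiffAt_const
  exact contDiffAt_const.mul (((h u v z).add (h v u z)).sub (h z u v))

end LocalCalculus

/-! ### Connection, curvature and Szabó operator of the extension in coordinates -/

section Extension

variable {E : Type*} [NormedAddCommGroup E] [NormedSpace ℝ E] [FiniteDimensional ℝ E]

/-- The Riemannian extension in induced coordinates, as a function on `E × E*`. -/
def extensionMetric (Γ : E → E →L[ℝ] E →L[ℝ] E) (y : E × (E →L[ℝ] ℝ)) :
    (E × (E →L[ℝ] ℝ)) →L[ℝ] (E × (E →L[ℝ] ℝ)) →L[ℝ] ℝ :=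
  riemannExtForm (Γ y.1) y.2

theorem extensionMetric_apply (Γ : E → E →L[ℝ] E →L[ℝ] E) (y U V : E × (E →L[ℝ] ℝ)) :
    extensionMetric Γ y U V = U.2 V.1 + V.2 U.1 - 2 * y.2 (Γ y.1 U.1 V.1) := rfl

/-- Pairing with vertical vectors `(0, f)` detects the base component of `U`; once that vanishes,
pairing with `(v, 0)` detects the covector component. Equality of dimensions turns injectivity into
invertibility. -/
theorem isInvertible_extensionMetric (Γ : E → E →L[ℝ] E →L[ℝ] E) (y : E × (E →L[ℝ] ℝ)) :
    (extensionMetric Γ y).IsInvertible := by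
  have hinj : Function.Injective (extensionMetric Γ y).toLinearMap := by
    rw [← LinearMap.ker_eq_bot, LinearMap.ker_eq_bot']
    intro U hU
    have h (V) : extensionMetric Γ y U V = 0 := DFunLike.congr_fun hU V
    have h1 : U.1 = 0 := by
      by_contra hne
      obtain ⟨f, hf⟩ := SeparatingDual.exists_ne_zero (R := ℝ) hne
      exact hf (by simpa [extensionMetric_apply] using h (0, f))
    refine Prod.ext h1 (ContinuousLinearMap.ext fun v ↦ ?_)
    simpa [extensionMetric_apply, h1] using h (v, 0)
  have hdim : Module.finrank ℝ (E × (E →L[ℝ] ℝ)) =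
      Module.finrank ℝ ((E × (E →L[ℝ] ℝ)) →L[ℝ] ℝ) := by
    rw [← (LinearMap.toContinuousLinearMap (𝕜 := ℝ) (E := E × (E →L[ℝ] ℝ))
      (F' := ℝ)).finrank_eq]
    exact (Subspace.dual_finrank_eq (K := ℝ) (V := E × (E →L[ℝ] ℝ))).symm
  exact ⟨((extensionMetric Γ y).toLinearMap.linearEquivOfInjective hinj
    hdim).toContinuousLinearEquiv, ContinuousLinearMap.ext fun _ ↦ rfl⟩

variable {Γ : E → E →L[ℝ] E →L[ℝ] E} {y : E × (E →L[ℝ] ℝ)}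

theorem contDiffAt_extensionMetric {n : WithTop ℕ∞} (hΓ : ContDiffAt ℝ n Γ y.1) :
    ContDiffAt ℝ n (extensionMetric Γ) y := by
  rw [contDiffAt_clm_apply_iff]
  intro U
  rw [contDiffAt_clm_apply_iff]
  intro V
  simp only [extensionMetric_apply]
  have h1 : ContDiffAt ℝ n (fun z : E × (E →L[ℝ] ℝ) ↦ Γ z.1) y := hΓ.comp y contDiffAt_fst
  have h2 := (contDiffAt_snd (𝕜 := ℝ) (n := n) (p := y)).clm_apply
    ((h1.clm_apply (contDiffAt_const (c := U.1))).clm_apply (contDiffAt_const (c := V.1)))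
  exact contDiffAt_const.sub (contDiffAt_const.mul h2)

theorem fderiv_extensionMetric (hΓ : ContDiffAt ℝ ∞ Γ y.1) (Z U V : E × (E →L[ℝ] ℝ)) :
    fderiv ℝ (extensionMetric Γ) y Z U V =
      -2 * (Z.2 (Γ y.1 U.1 V.1) + y.2 (fderiv ℝ Γ y.1 Z.1 U.1 V.1)) := by
  have hG : DifferentiableAt ℝ (extensionMetric Γ) y :=
    (contDiffAt_extensionMetric hΓ).differentiableAt (by simp)
  rw [← fderiv_clm_apply_apply_const hG]
  simp only [extensionMetric_apply]
  have h1 : HasFDerivAt (fun z : E × (E →L[ℝ] ℝ) ↦ Γ z.1) _ y :=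
    (hΓ.differentiableAt (by simp)).hasFDerivAt.comp y hasFDerivAt_fst
  have h2 := (((hasFDerivAt_snd (𝕜 := ℝ) (p := y)).clm_apply
    ((h1.clm_apply (hasFDerivAt_const U.1 y)).clm_apply (hasFDerivAt_const V.1 y))).const_mul
    (2 : ℝ)).const_sub (U.2 V.1 + V.2 U.1)
  rw [h2.fderiv]
  simp
  ring

/-- Checked by lowering the index. Pairing with a vertical vector isolates the base component
`Γ(u,v)`; the summand `2Γ(Γ(u,v),·)` compensates the `-2ζ(Γ(·,·))` block of the metric evaluated on
that component. -/
theorem localLeviCivita_extensionMetric (hΓ : ContDiffAt ℝ ∞ Γ y.1) (U V : E × (E →L[ℝ] ℝ)) :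
    localLeviCivita (extensionMetric Γ) y U V =
      (Γ y.1 U.1 V.1, y.2.comp (((fderiv ℝ Γ y.1).flip U.1).flip V.1 - fderiv ℝ Γ y.1 U.1 V.1
        - fderiv ℝ Γ y.1 V.1 U.1 + (2 : ℝ) • Γ y.1 (Γ y.1 U.1 V.1))
        - U.2.comp (Γ y.1 V.1) - V.2.comp (Γ y.1 U.1)) := by
  rw [localLeviCivita_apply, (isInvertible_extensionMetric Γ y).inverse_apply_eq]
  refine ContinuousLinearMap.ext fun W ↦ ?_
  rw [localChristoffelFirst_apply]
  simp only [fderiv_extensionMetric hΓ, extensionMetric_apply]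
  simp
  ring


theorem contDiffAt_localLeviCivita_extensionMetric (hΓ : ContDiffAt ℝ ∞ Γ y.1) :
    ContDiffAt ℝ ∞ (localLeviCivita (extensionMetric Γ)) y :=
  contDiffAt_localLeviCivita (contDiffAt_extensionMetric hΓ) (isInvertible_extensionMetric Γ y)

theorem localLeviCivita_extensionMetric_vertical_left (hΓ : ContDiffAt ℝ ∞ Γ y.1)
    (b : E →L[ℝ] ℝ) (V : E × (E →L[ℝ] ℝ)) :
    localLeviCivita (extensionMetric Γ) y (0, b) V = (0, -b.comp (Γ y.1 V.1)) := by
  rw [localLeviCivita_extensionMetric hΓ]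
  ext <;> simp

theorem localLeviCivita_extensionMetric_vertical_right (hΓ : ContDiffAt ℝ ∞ Γ y.1)
    (b : E →L[ℝ] ℝ) (U : E × (E →L[ℝ] ℝ)) :
    localLeviCivita (extensionMetric Γ) y U (0, b) = (0, -b.comp (Γ y.1 U.1)) := by
  rw [localLeviCivita_extensionMetric hΓ]
  ext <;> simp

/-- The base component is the pullback of `Γ` along the projection. The formula is differentiated,
so smoothness is required at nearby points as well. -/
theorem fderiv_fst_localLeviCivita (hs : ∀ᶠ x in 𝓝 y.1, ContDiffAt ℝ ∞ Γ x)
    (Z U V : E × (E →L[ℝ] ℝ)) :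
    (fderiv ℝ (localLeviCivita (extensionMetric Γ)) y Z U V).1 =
      fderiv ℝ Γ y.1 Z.1 U.1 V.1 := by
  have hΓ := hs.self_of_nhds
  have hd := (contDiffAt_localLeviCivita_extensionMetric hΓ).differentiableAt (by simp)
  have h1 : (fun z ↦ (localLeviCivita (extensionMetric Γ) z U V).1) =ᶠ[𝓝 y]
      fun z ↦ Γ z.1 U.1 V.1 := by
    filter_upwards [continuousAt_fst.eventually hs] with z hz
    rw [localLeviCivita_extensionMetric hz]
  have h2 : HasFDerivAt (fun z : E × (E →L[ℝ] ℝ) ↦ Γ z.1) _ y :=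
    (hΓ.differentiableAt (by simp)).hasFDerivAt.comp y hasFDerivAt_fst
  have h3 := (h2.clm_apply (hasFDerivAt_const U.1 y)).clm_apply (hasFDerivAt_const V.1 y)
  have h4 := (hd.hasFDerivAt.clm_apply (hasFDerivAt_const U y)).clm_apply (hasFDerivAt_const V y)
  have h5 := (hasFDerivAt_fst.comp y h4).unique (h3.congr_of_eventuallyEq h1)
  simpa using DFunLike.congr_fun h5 Z

theorem fderiv_localLeviCivita_vertical_left (hs : ∀ᶠ x in 𝓝 y.1, ContDiffAt ℝ ∞ Γ x)
    (b : E →L[ℝ] ℝ) (Z V : E × (E →L[ℝ] ℝ)) :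
    fderiv ℝ (localLeviCivita (extensionMetric Γ)) y Z (0, b) V =
      (0, -b.comp (fderiv ℝ Γ y.1 Z.1 V.1)) := by
  have hΓ := hs.self_of_nhds
  have hd := (contDiffAt_localLeviCivita_extensionMetric hΓ).differentiableAt (by simp)
  have h1 : (fun z ↦ localLeviCivita (extensionMetric Γ) z (0, b) V) =ᶠ[𝓝 y]
      fun z ↦ ((0 : E), -b.comp (Γ z.1 V.1)) := by
    filter_upwards [continuousAt_fst.eventually hs] with z hz
    rw [localLeviCivita_extensionMetric_vertical_left hz]
  have h2 : HasFDerivAt (fun z : E × (E →L[ℝ] ℝ) ↦ Γ z.1) _ y :=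
    (hΓ.differentiableAt (by simp)).hasFDerivAt.comp y hasFDerivAt_fst
  have h3 := (hasFDerivAt_const (0 : E) y).prodMk
    ((hasFDerivAt_const b y).clm_comp (h2.clm_apply (hasFDerivAt_const V.1 y))).neg
  have h4 := (hd.hasFDerivAt.clm_apply (hasFDerivAt_const ((0 : E), b) y)).clm_apply
    (hasFDerivAt_const V y)
  have h5 := h4.unique (h3.congr_of_eventuallyEq h1)
  simpa using DFunLike.congr_fun h5 Z

/-- Along the fibre through `y` the symbols are affine in the covector, with `Γ` and its derivative
frozen. Restricting to the fibre thus avoids second derivatives of `Γ`. -/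
theorem fderiv_localLeviCivita_of_vertical (hs : ∀ᶠ x in 𝓝 y.1, ContDiffAt ℝ ∞ Γ x)
    (b : E →L[ℝ] ℝ) (U V : E × (E →L[ℝ] ℝ)) :
    fderiv ℝ (localLeviCivita (extensionMetric Γ)) y (0, b) U V =
      (0, b.comp (((fderiv ℝ Γ y.1).flip U.1).flip V.1 - fderiv ℝ Γ y.1 U.1 V.1
        - fderiv ℝ Γ y.1 V.1 U.1 + (2 : ℝ) • Γ y.1 (Γ y.1 U.1 V.1))) := by
  have hΓ := hs.self_of_nhds
  have hd := (contDiffAt_localLeviCivita_extensionMetric hΓ).differentiableAt (by simp)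
  set A := ((fderiv ℝ Γ y.1).flip U.1).flip V.1 - fderiv ℝ Γ y.1 U.1 V.1
        - fderiv ℝ Γ y.1 V.1 U.1 + (2 : ℝ) • Γ y.1 (Γ y.1 U.1 V.1) with hA
  have h1 (t : E →L[ℝ] ℝ) : localLeviCivita (extensionMetric Γ) (y.1, t) U V =
      (Γ y.1 U.1 V.1, t.comp A - U.2.comp (Γ y.1 V.1) - V.2.comp (Γ y.1 U.1)) :=
    localLeviCivita_extensionMetric (y := (y.1, t)) hΓ U V
  have h3 := (hasFDerivAt_const (Γ y.1 U.1 V.1) y.2).prodMk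
    ((((hasFDerivAt_id y.2).clm_comp (hasFDerivAt_const A y.2)).sub_const
      (U.2.comp (Γ y.1 V.1))).sub_const (V.2.comp (Γ y.1 U.1)))
  have h4 := (hd.hasFDerivAt.clm_apply (hasFDerivAt_const U y)).clm_apply
    (hasFDerivAt_const V y)
  have h5 := HasFDerivAt.comp y.2 (f := fun t ↦ (y.1, t)) h4 (hasFDerivAt_prodMk_right y.1 y.2)
  have h6 := h5.unique (h3.congr_of_eventuallyEq (.of_forall h1))
  simpa using DFunLike.congr_fun h6 b

theorem fst_localCurvature_extensionMetric (hs : ∀ᶠ x in 𝓝 y.1, ContDiffAt ℝ ∞ Γ x)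
    (V W U : E × (E →L[ℝ] ℝ)) :
    (localCurvature (localLeviCivita (extensionMetric Γ)) y V W U).1 =
      localCurvature Γ y.1 V.1 W.1 U.1 := by
  have hΓ := hs.self_of_nhds
  rw [localCurvature_eq_fderiv
    ((contDiffAt_localLeviCivita_extensionMetric hΓ).differentiableAt (by simp)),
    localCurvature_eq_fderiv (hΓ.differentiableAt (by simp))]
  simp only [Prod.fst_add, Prod.fst_sub, fderiv_fst_localLeviCivita hs,
    localLeviCivita_extensionMetric hΓ]

/-- Conceptually this is the pair symmetry `g(R(b,V)W,U) = g(R(W,U)b,V) = b(R(U,W)V)`, using that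
`g` pairs a vertical `b` with a vector through its base component. This explains the exchange of `V`
and `W`. The proof expands both sides and uses the symmetry of `Γ`. -/
theorem localCurvature_extensionMetric_vertical (hs : ∀ᶠ x in 𝓝 y.1, ContDiffAt ℝ ∞ Γ x)
    (hsymm : ∀ᶠ x in 𝓝 y.1, ∀ u v, Γ x u v = Γ x v u)
    (V W : E × (E →L[ℝ] ℝ)) (b : E →L[ℝ] ℝ) :
    localCurvature (localLeviCivita (extensionMetric Γ)) y V W (0, b) =
      (0, b.comp (localCurvature Γ y.1 W.1 V.1)) := by
  have hΓ := hs.self_of_nhds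
  have hd := hΓ.differentiableAt (by simp)
  -- Symmetry on a neighbourhood is inherited by the derivative of `Γ`.
  have hsymm' (u v w : E) : fderiv ℝ Γ y.1 u v w = fderiv ℝ Γ y.1 u w v := by
    rw [← fderiv_clm_apply_apply_const hd, ← fderiv_clm_apply_apply_const hd]
    exact DFunLike.congr_fun (Filter.EventuallyEq.fderiv_eq (hsymm.mono fun z hz ↦ hz v w)) u
  rw [localCurvature_eq_fderiv
    ((contDiffAt_localLeviCivita_extensionMetric hΓ).differentiableAt (by simp)),
    fderiv_localLeviCivita_of_vertical hs, fderiv_localLeviCivita_vertical_left hs,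
    localLeviCivita_extensionMetric_vertical_left hΓ,
    localLeviCivita_extensionMetric_vertical_left hΓ,
    localLeviCivita_extensionMetric_vertical_right hΓ,
    localLeviCivita_extensionMetric hΓ]
  refine Prod.ext (by simp) (ContinuousLinearMap.ext fun u ↦ ?_)
  simp only [Prod.snd_add, Prod.snd_sub, add_apply, sub_apply,
    neg_apply, ContinuousLinearMap.comp_apply, localCurvature_eq_fderiv hd]
  have := hsymm.self_of_nhds
  simp [hsymm' u W.1 V.1, this u]
  rw [this W.1, hsymm' W.1 u V.1]
  ring

theorem fst_localSzabo_extensionMetric (hs : ∀ᶠ x in 𝓝 y.1, ContDiffAt ℝ ∞ Γ x)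
    (X Y : E × (E →L[ℝ] ℝ)) :
    (localSzabo (localLeviCivita (extensionMetric Γ)) y X Y).1 = localSzabo Γ y.1 X.1 Y.1 := by
  have hΓ := hs.self_of_nhds
  have hd := (contDiffAt_localCurvature
    (contDiffAt_localLeviCivita_extensionMetric hΓ) X X).differentiableAt (by simp)
  have hd' := (contDiffAt_localCurvature hΓ X.1 X.1).differentiableAt (by simp)
  have h1 : (fun z ↦ (localCurvature (localLeviCivita (extensionMetric Γ)) z X X Y).1) =ᶠ[𝓝 y]
      fun z ↦ localCurvature Γ z.1 X.1 X.1 Y.1 := by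
    filter_upwards [continuousAt_fst.eventually hs.eventually_nhds] with z hz
    rw [fst_localCurvature_extensionMetric hz]
  have h2 : HasFDerivAt (fun z : E × (E →L[ℝ] ℝ) ↦ localCurvature Γ z.1 X.1 X.1) _ y :=
    hd'.hasFDerivAt.comp y hasFDerivAt_fst
  have h3 := h2.clm_apply (hasFDerivAt_const Y.1 y)
  have h4 := hd.hasFDerivAt.clm_apply (hasFDerivAt_const Y y)
  have h5 := (hasFDerivAt_fst.comp y h4).unique (h3.congr_of_eventuallyEq h1)
  have h6 : (fderiv ℝ (fun z ↦ localCurvature (localLeviCivita (extensionMetric Γ)) z X X)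
      y X Y).1 = fderiv ℝ (fun z ↦ localCurvature Γ z X.1 X.1) y.1 X.1 Y.1 := by
    simpa using DFunLike.congr_fun h5 X
  simp only [localSzabo, localCurvatureDeriv, sub_apply, add_apply,
    ContinuousLinearMap.comp_apply, Prod.fst_sub, Prod.fst_add, h6,
    fst_localCurvature_extensionMetric hs, localLeviCivita_extensionMetric hΓ]

theorem localSzabo_extensionMetric_vertical (hs : ∀ᶠ x in 𝓝 y.1, ContDiffAt ℝ ∞ Γ x)
    (hsymm : ∀ᶠ x in 𝓝 y.1, ∀ u v, Γ x u v = Γ x v u)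
    (X : E × (E →L[ℝ] ℝ)) (b : E →L[ℝ] ℝ) :
    localSzabo (localLeviCivita (extensionMetric Γ)) y X (0, b) =
      (0, b.comp (localSzabo Γ y.1 X.1)) := by
  have hΓ := hs.self_of_nhds
  have hd := (contDiffAt_localCurvature
    (contDiffAt_localLeviCivita_extensionMetric hΓ) X X).differentiableAt (by simp)
  have hd' := (contDiffAt_localCurvature hΓ X.1 X.1).differentiableAt (by simp)
  have h1 : (fun z ↦ localCurvature (localLeviCivita (extensionMetric Γ)) z X X (0, b)) =ᶠ[𝓝 y]
      fun z ↦ ((0 : E), b.comp (localCurvature Γ z.1 X.1 X.1)) := by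
    filter_upwards [continuousAt_fst.eventually hs.eventually_nhds,
      continuousAt_fst.eventually hsymm.eventually_nhds] with z hz hz'
    rw [localCurvature_extensionMetric_vertical hz hz']
  have h2 : HasFDerivAt (fun z : E × (E →L[ℝ] ℝ) ↦ localCurvature Γ z.1 X.1 X.1) _ y :=
    hd'.hasFDerivAt.comp y hasFDerivAt_fst
  have h3 := (hasFDerivAt_const (0 : E) y).prodMk ((hasFDerivAt_const b y).clm_comp h2)
  have h4 := hd.hasFDerivAt.clm_apply (hasFDerivAt_const ((0 : E), b) y)
  have h5 := h4.unique (h3.congr_of_eventuallyEq h1)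
  have h6 : fderiv ℝ (fun z ↦ localCurvature (localLeviCivita (extensionMetric Γ)) z X X)
      y X (0, b) = (0, b.comp (fderiv ℝ (fun z ↦ localCurvature Γ z X.1 X.1) y.1 X.1)) := by
    simpa using DFunLike.congr_fun h5 X
  simp only [localSzabo, localCurvatureDeriv, sub_apply, add_apply,
    ContinuousLinearMap.comp_apply, h6, localCurvature_extensionMetric_vertical hs hsymm,
    localLeviCivita_extensionMetric_vertical_right hΓ]
  -- Transposition turns the term `Γ(X,R(·))` into the term `R(Γ(X,·))` and conversely, with
  -- matching signs. The exchange of the two curvature slots only permutes the last two corrections,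
  -- since both slots hold `X`.
  refine Prod.ext (by simp) (ContinuousLinearMap.ext fun u ↦ ?_)
  simp [localLeviCivita_extensionMetric hΓ]
  ring

end Extension

/-! ### Spectrum of a block triangular operator with transposed blocks -/

section Spectrum

variable {E : Type*} [NormedAddCommGroup E] [NormedSpace ℝ E] [FiniteDimensional ℝ E]

/-- The characteristic polynomial of an endomorphism of `E × E*` which is block triangular, with
diagonal blocks an endomorphism of `E` and its transpose. -/
theorem charpoly_eq_sq_of_transpose {f : (E × (E →L[ℝ] ℝ)) →ₗ[ℝ] (E × (E →L[ℝ] ℝ))}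
    {S : E →L[ℝ] E} (h1 : ∀ Y, (f Y).1 = S Y.1)
    (h2 : ∀ b : E →L[ℝ] ℝ, f (0, b) = (0, b.comp S)) :
    f.charpoly = S.toLinearMap.charpoly ^ 2 := by
  classical
  let b := Module.finBasis ℝ E
  let b' := b.dualBasis.map (LinearMap.toContinuousLinearMap (𝕜 := ℝ) (E := E) (F' := ℝ))
  have hb' (i) (v : E) : b' i v = b.repr v i := by simp [b']
  have hr (c : E →L[ℝ] ℝ) (i) : b'.repr c i = c (b i) := by
    simp [b']
  set A := LinearMap.toMatrix b b S.toLinearMap with hA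
  -- In the dual basis precomposition with `S` has matrix exactly `A.transpose`; the lower left
  -- block is left arbitrary.
  have hM : LinearMap.toMatrix (b.prod b') (b.prod b') f = Matrix.fromBlocks A 0
      (LinearMap.toMatrix (b.prod b') (b.prod b') f).toBlocks₂₁ A.transpose := by
    ext (i | i) (j | j)
    · simp [LinearMap.toMatrix_apply, h1, hA]
    · simp [LinearMap.toMatrix_apply, h1]
    · simp [Matrix.toBlocks₂₁]
    · simp [LinearMap.toMatrix_apply, h2, hA, hr, hb']
  rw [← LinearMap.charpoly_toMatrix f (b.prod b'), hM, Matrix.charpoly_fromBlocks_zero₁₂,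
    Matrix.charpoly_transpose, hA, LinearMap.charpoly_toMatrix, sq]

theorem spectrum_eq_of_charpoly_eq_sq {K V W : Type*} [Field K] [AddCommGroup V] [Module K V]
    [AddCommGroup W] [Module K W] [FiniteDimensional K V] [FiniteDimensional K W]
    {f : V →ₗ[K] V} {g : W →ₗ[K] W} (h : f.charpoly = g.charpoly ^ 2) :
    spectrum K f = spectrum K g := by
  ext μ
  rw [Module.End.mem_spectrum_iff_isRoot_charpoly, Module.End.mem_spectrum_iff_isRoot_charpoly, h,
    Polynomial.IsRoot, Polynomial.IsRoot, Polynomial.eval_pow, sq_eq_zero_iff]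

theorem spectrum_eq_of_transpose {f : (E × (E →L[ℝ] ℝ)) →ₗ[ℝ] (E × (E →L[ℝ] ℝ))}
    {S : E →L[ℝ] E} (h1 : ∀ Y, (f Y).1 = S Y.1)
    (h2 : ∀ b : E →L[ℝ] ℝ, f (0, b) = (0, b.comp S)) :
    spectrum ℝ f = spectrum ℝ S.toLinearMap ∧
      spectrum ℂ (f.baseChange ℂ) = spectrum ℂ (S.toLinearMap.baseChange ℂ) := by
  have h := charpoly_eq_sq_of_transpose h1 h2
  refine ⟨spectrum_eq_of_charpoly_eq_sq h, spectrum_eq_of_charpoly_eq_sq ?_⟩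
  rw [LinearMap.charpoly_baseChange, LinearMap.charpoly_baseChange, h, Polynomial.map_pow]

end Spectrum

/-! ### Christoffel symbols of a connection in a chart -/

section Christoffel

variable {E : Type*} [NormedAddCommGroup E] [NormedSpace ℝ E]
  {M : Type*} [TopologicalSpace M] [ChartedSpace E M] [IsManifold 𝓘(ℝ, E) ∞ M]

theorem mem_baseSet_iff {p q : M} :
    q ∈ (trivializationAt E (TangentSpace 𝓘(ℝ, E) : M → Type _) p).baseSet ↔
      q ∈ (extChartAt 𝓘(ℝ, E) p).source := by
  rw [extChartAt_source, TangentBundle.trivializationAt_baseSet]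

theorem extChartAt_symm_mem_baseSet {p : M} {x : E} (hx : x ∈ (extChartAt 𝓘(ℝ, E) p).target) :
    (extChartAt 𝓘(ℝ, E) p).symm x ∈
      (trivializationAt E (TangentSpace 𝓘(ℝ, E) : M → Type _) p).baseSet :=
  mem_baseSet_iff.2 ((extChartAt 𝓘(ℝ, E) p).map_target hx)

theorem continuousLinearMapAt_eq_snd (p : M) {q : M}
    (hq : q ∈ (trivializationAt E (TangentSpace 𝓘(ℝ, E) : M → Type _) p).baseSet)
    (v : TangentSpace 𝓘(ℝ, E) q) :
    (trivializationAt E (TangentSpace 𝓘(ℝ, E) : M → Type _) p).continuousLinearMapAt ℝ q v =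
      (trivializationAt E (TangentSpace 𝓘(ℝ, E) : M → Type _) p ⟨q, v⟩).2 := by
  rw [Trivialization.continuousLinearMapAt_apply, Trivialization.coe_linearMapAt_of_mem _ hq]

theorem contMDiffAt_coordField (p : M) (v : E) {q : M}
    (hq : q ∈ (trivializationAt E (TangentSpace 𝓘(ℝ, E) : M → Type _) p).baseSet) :
    CMDiffAt ∞ (T% (coordField p v)) q := by
  rw [(trivializationAt E (TangentSpace 𝓘(ℝ, E) : M → Type _) p).contMDiffAt_section_iff hq]
  refine (contMDiffAt_const (c := v)).congr_of_eventuallyEq ?_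
  filter_upwards [(trivializationAt E (TangentSpace 𝓘(ℝ, E) : M → Type _) p).open_baseSet.mem_nhds
    hq] with x hx
  rw [coordField, Trivialization.symmL_apply _ hx, Trivialization.apply_mk_symm _ hx]

/-- Near any point of its domain, a coordinate field agrees with a smooth global field. -/
theorem exists_contMDiff_eventuallyEq_coordField [FiniteDimensional ℝ E] [T2Space M]
    (p : M) (v : E) {q : M}
    (hq : q ∈ (trivializationAt E (TangentSpace 𝓘(ℝ, E) : M → Type _) p).baseSet) :
    ∃ σ : Π x : M, TangentSpace 𝓘(ℝ, E) x, CMDiff ∞ (T% σ) ∧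
      ∀ᶠ x in 𝓝 q, coordField p v x = σ x := by
  set U := (trivializationAt E (TangentSpace 𝓘(ℝ, E) : M → Type _) p).baseSet
  have hU : IsOpen U := (trivializationAt E (TangentSpace 𝓘(ℝ, E) : M → Type _) p).open_baseSet
  -- Outside `U` the coordinate field is only a default value, so the cut-off must have its closed
  -- support inside `U`.
  obtain ⟨χ, -, hχ⟩ := (SmoothBumpFunction.nhds_basis_tsupport (I := 𝓘(ℝ, E)) q).mem_iff.1
    (hU.mem_nhds hq)
  refine ⟨(χ : M → ℝ) • coordField p v, ?_, ?_⟩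
  · exact ContMDiffOn.smul_section_of_tsupport χ.contMDiff.contMDiffOn hU hχ
      fun x hx ↦ (contMDiffAt_coordField p v hx).contMDiffWithinAt
  · filter_upwards [χ.eventuallyEq_one] with x hx
    simp [hx]

/-- The constant vector field on a vector space. -/
def constField (v : E) (x : E) : TangentSpace 𝓘(ℝ, E) x := v

theorem coordField_eq_mpullback (p : M) (v : E) {q : M}
    (hq : q ∈ (trivializationAt E (TangentSpace 𝓘(ℝ, E) : M → Type _) p).baseSet) :
    coordField p v q =
      VectorField.mpullback 𝓘(ℝ, E) 𝓘(ℝ, E) (extChartAt 𝓘(ℝ, E) p) (constField v) q := by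
  have hq' : q ∈ (chartAt E p).source := hq
  have h : (mfderiv 𝓘(ℝ, E) 𝓘(ℝ, E) (extChartAt 𝓘(ℝ, E) p) q).IsInvertible :=
    isInvertible_mfderiv_extChartAt (mem_baseSet_iff.1 hq)
  rw [VectorField.mpullback_apply, eq_comm, h.inverse_apply_eq,
    ← TangentBundle.continuousLinearMapAt_trivializationAt hq']
  exact (Trivialization.continuousLinearMapAt_symmL _ hq v).symm

theorem mlieBracket_constField (u v : E) (x : E) :
    VectorField.mlieBracket 𝓘(ℝ, E) (constField u) (constField v) x = 0 := by
  rw [← VectorField.mlieBracketWithin_univ, VectorField.mlieBracketWithin_eq_lieBracketWithin]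
  change VectorField.lieBracketWithin ℝ (fun _ : E ↦ u) (fun _ ↦ v) Set.univ x = 0
  simp [VectorField.lieBracketWithin]

/-- Coordinate fields are pullbacks of constant fields under the chart, and the Lie bracket is
natural under pullback. -/
theorem mlieBracket_coordField [FiniteDimensional ℝ E] (p : M) (u v : E) {q : M}
    (hq : q ∈ (trivializationAt E (TangentSpace 𝓘(ℝ, E) : M → Type _) p).baseSet) :
    VectorField.mlieBracket 𝓘(ℝ, E) (coordField p u) (coordField p v) q = 0 := by
  have : CompleteSpace E := FiniteDimensional.complete ℝ E
  have h (w : E) : coordField p w =ᶠ[𝓝 q]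
      VectorField.mpullback 𝓘(ℝ, E) 𝓘(ℝ, E) (extChartAt 𝓘(ℝ, E) p) (constField w) := by
    filter_upwards [(trivializationAt E
      (TangentSpace 𝓘(ℝ, E) : M → Type _) p).open_baseSet.mem_nhds hq] with x hx
    exact coordField_eq_mpullback p w hx
  have hc (w : E) (x : E) : MDiffAt (T% (constField w)) x :=
    ((contMDiffAt_vectorSpace_iff_contDiffAt (n := 1)).2
      contDiffAt_const).mdifferentiableAt one_ne_zero
  have : IsManifold 𝓘(ℝ, E) (minSmoothness ℝ 3) M := by
    rw [minSmoothness_of_isRCLikeNormedField]; infer_instance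
  rw [(h u).mlieBracket_vectorField_eq (h v), ← VectorField.mpullback_mlieBracket (n := ∞)
    (hc u _) (hc v _) (contMDiffAt_extChartAt' hq)
    (by rw [minSmoothness_of_isRCLikeNormedField]; exact ENat.LEInfty.out), VectorField.mpullback_apply,
    mlieBracket_constField, map_zero]

variable [FiniteDimensional ℝ E]
  {cov : CovariantDerivative 𝓘(ℝ, E) E (TangentSpace 𝓘(ℝ, E) : M → Type _)}

/-- Smoothness of the connection is applied to global smooth fields, so the coordinate field is
first replaced by a global field with the same germ. -/
theorem contDiffAt_christoffel [T2Space M]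
    (hcov : CovariantDerivative.ContMDiffCovariantDerivative cov ∞) (p : M) {x : E}
    (hx : x ∈ (extChartAt 𝓘(ℝ, E) p).target) : ContDiffAt ℝ ∞ (christoffel cov p) x := by
  rw [contDiffAt_clm_apply_iff]
  intro u
  rw [contDiffAt_clm_apply_iff]
  intro v
  have hq := extChartAt_symm_mem_baseSet hx
  set q := (extChartAt 𝓘(ℝ, E) p).symm x with hqdef
  set e := trivializationAt E (TangentSpace 𝓘(ℝ, E) : M → Type _) p
  obtain ⟨σ, hσ, hvσ⟩ := exists_contMDiff_eventuallyEq_coordField p v hq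
  have h1 := (hcov.contMDiff.contMDiff (σ := σ) (by simpa using hσ.contMDiffOn)).contMDiffAt
    (x := q) univ_mem
  have h2 := h1.clm_bundle_apply (contMDiffAt_coordField p u hq)
  rw [e.contMDiffAt_section_iff hq] at h2
  have h3 : ContMDiffAt 𝓘(ℝ, E) 𝓘(ℝ, E) ∞ (extChartAt 𝓘(ℝ, E) p).symm x :=
    (contMDiffOn_extChartAt_symm p).contMDiffAt
      ((isOpen_extChartAt_target p).mem_nhds hx)
  have h4 := (h2.comp x h3).contDiffAt
  refine h4.congr_of_eventuallyEq ?_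
  -- The covariant derivative at `y` depends on the germ at `y`, so agreement is needed near every
  -- `y` close to `q`.
  have hσ' : ∀ᶠ y in 𝓝 q, y ∈ e.baseSet ∧ ∀ᶠ z in 𝓝 y, coordField p v z = σ z :=
    (e.open_baseSet.eventually_mem hq).and hvσ.eventually_nhds
  filter_upwards [h3.continuousAt.eventually hσ'] with y hy
  rw [christoffel_apply, cov.isCovariantDerivativeOnUniv.congr_of_eventuallyEq
    (mdifferentiableAt_coordField p v hy.1) (hσ.mdifferentiable (by simp) _) univ_mem hy.2]
  exact continuousLinearMapAt_eq_snd p hy.1 _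

/-- Torsion measures the antisymmetric part of `Γ` on coordinate fields, because these commute. -/
theorem christoffel_symm (htors : cov.torsion = 0) (p : M) {x : E}
    (hx : x ∈ (extChartAt 𝓘(ℝ, E) p).target) (u v : E) :
    christoffel cov p x u v = christoffel cov p x v u := by
  have hq := extChartAt_symm_mem_baseSet hx
  have h := cov.torsion_eq_zero_iff.1 htors (mdifferentiableAt_coordField p u hq)
    (mdifferentiableAt_coordField p v hq)
  rw [mlieBracket_coordField p u v hq, sub_eq_zero] at h
  rw [christoffel_apply, christoffel_apply, h]

omit [FiniteDimensional ℝ E] in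
theorem _root_.CovariantDerivative.sum_smul {ι : Type*} [Fintype ι] {f : ι → M → ℝ}
    {σ : ι → Π x : M, TangentSpace 𝓘(ℝ, E) x} {x : M} (hf : ∀ i, MDiffAt (f i) x)
    (hσ : ∀ i, MDiffAt (T% (σ i)) x) :
    cov (∑ i, f i • σ i) x = ∑ i, (f i x • cov (σ i) x + (d% (f i) x).smulRight (σ i x)) := by
  classical
  -- The additivity rule asks for differentiability of the partial sums, which is therefore carried
  -- through the induction.
  suffices ∀ s : Finset ι, MDiffAt (T% (∑ i ∈ s, f i • σ i)) x ∧ cov (∑ i ∈ s, f i • σ i) x =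
    ∑ i ∈ s, (f i x • cov (σ i) x + (d% (f i) x).smulRight (σ i x)) from (this Finset.univ).2
  intro s
  induction s using Finset.induction_on with
  | empty =>
    exact ⟨mdifferentiableAt_zeroSection .., by
      simp⟩
  | insert i s hi ih =>
    have h := (hf i).smul_section (hσ i)
    rw [Finset.sum_insert hi, Finset.sum_insert hi, cov.isCovariantDerivativeOnUniv.add h ih.1,
      cov.isCovariantDerivativeOnUniv.leibniz (hσ i) (hf i), ih.2]
    exact ⟨mdifferentiableAt_add_section h ih.1, rfl⟩

omit [FiniteDimensional ℝ E] in
theorem mfderiv_coordField {F : Type*} [NormedAddCommGroup F] [NormedSpace ℝ F] (p : M) {x : E}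
    (hx : x ∈ (extChartAt 𝓘(ℝ, E) p).target) {s : M → F}
    (hs : MDiffAt s ((extChartAt 𝓘(ℝ, E) p).symm x)) (u : E) :
    mfderiv 𝓘(ℝ, E) 𝓘(ℝ, F) s ((extChartAt 𝓘(ℝ, E) p).symm x)
      (coordField p u ((extChartAt 𝓘(ℝ, E) p).symm x)) =
    fderiv ℝ (fun x' ↦ s ((extChartAt 𝓘(ℝ, E) p).symm x')) x u := by
  have h1 : MDifferentiableAt 𝓘(ℝ, E) 𝓘(ℝ, E) (extChartAt 𝓘(ℝ, E) p).symm x :=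
    ((contMDiffOn_extChartAt_symm (n := 1) p).contMDiffAt
      ((isOpen_extChartAt_target p).mem_nhds hx)).mdifferentiableAt one_ne_zero
  have h2 : coordField p u ((extChartAt 𝓘(ℝ, E) p).symm x) =
      mfderiv 𝓘(ℝ, E) 𝓘(ℝ, E) (extChartAt 𝓘(ℝ, E) p).symm x u := by
    rw [coordField, TangentBundle.symmL_trivializationAt (I := 𝓘(ℝ, E))
      (extChartAt_symm_mem_baseSet hx), (extChartAt 𝓘(ℝ, E) p).right_inv hx]
    simp only [modelWithCornersSelf_coe, Set.range_id, mfderivWithin_univ]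
    rfl
  rw [h2, ← mfderiv_eq_fderiv]
  exact (DFunLike.congr_fun (mfderiv_comp x hs h1) u).symm

/-- The classical `∇_u σ = ∂_u s + Γ(u, s)`: expand `σ` in a coordinate frame and apply the Leibniz
rule. Applied to the frame of a second chart, it yields the transformation law of `Γ`. -/
theorem continuousLinearMapAt_cov (p : M) {x : E} (hx : x ∈ (extChartAt 𝓘(ℝ, E) p).target)
    {σ : Π q : M, TangentSpace 𝓘(ℝ, E) q}
    (hσ : MDiffAt (T% σ) ((extChartAt 𝓘(ℝ, E) p).symm x)) (u : E) :
    (trivializationAt E (TangentSpace 𝓘(ℝ, E) : M → Type _) p).continuousLinearMapAt ℝ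
        ((extChartAt 𝓘(ℝ, E) p).symm x) (cov σ ((extChartAt 𝓘(ℝ, E) p).symm x)
        (coordField p u ((extChartAt 𝓘(ℝ, E) p).symm x))) =
      fderiv ℝ (fun x' ↦ (trivializationAt E (TangentSpace 𝓘(ℝ, E) : M → Type _)
        p).continuousLinearMapAt ℝ ((extChartAt 𝓘(ℝ, E) p).symm x')
          (σ ((extChartAt 𝓘(ℝ, E) p).symm x'))) x u +
      christoffel cov p x u ((trivializationAt E (TangentSpace 𝓘(ℝ, E) : M → Type _)
        p).continuousLinearMapAt ℝ ((extChartAt 𝓘(ℝ, E) p).symm x)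
          (σ ((extChartAt 𝓘(ℝ, E) p).symm x))) := by
  have hq := extChartAt_symm_mem_baseSet hx
  let b := Module.finBasis ℝ E
  let s (q : M) : E := (trivializationAt E (TangentSpace 𝓘(ℝ, E) : M → Type _)
    p).continuousLinearMapAt ℝ q (σ q)
  have hs : MDiffAt s ((extChartAt 𝓘(ℝ, E) p).symm x) := by
    rw [(trivializationAt E (TangentSpace 𝓘(ℝ, E) : M → Type _) p).mdifferentiableAt_section_iff
      _ _ hq] at hσ
    refine hσ.congr_of_eventuallyEq ?_
    filter_upwards [(trivializationAt E (TangentSpace 𝓘(ℝ, E) : M → Type _)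
      p).open_baseSet.mem_nhds hq] with y hy
    exact continuousLinearMapAt_eq_snd p hy _
  let c (i) : E →L[ℝ] ℝ := (b.coord i).toContinuousLinearMap
  have hf (i) : HasMFDerivAt 𝓘(ℝ, E) 𝓘(ℝ, ℝ) (fun q ↦ c i (s q)) ((extChartAt 𝓘(ℝ, E) p).symm x)
      ((c i).comp (mfderiv 𝓘(ℝ, E) 𝓘(ℝ, E) s ((extChartAt 𝓘(ℝ, E) p).symm x))) :=
    (c i).hasMFDerivAt.comp _ hs.hasMFDerivAt
  have hsum (q : M) (hq : q ∈ (trivializationAt E (TangentSpace 𝓘(ℝ, E) : M → Type _) p).baseSet) :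
      σ q = (∑ i, (fun q ↦ c i (s q)) • coordField p (b i)) q := by
    rw [← Trivialization.symmL_continuousLinearMapAt (R := ℝ) _ hq (σ q)]
    conv_lhs => rw [← b.sum_repr (Trivialization.continuousLinearMapAt ℝ _ q (σ q))]
    simp only [map_sum, map_smul, Finset.sum_apply]
    rfl
  have hcf (i) := mdifferentiableAt_coordField p (b i) hq
  have hd : MDiffAt (T% (∑ i, (fun q ↦ c i (s q)) • coordField p (b i)))
      ((extChartAt 𝓘(ℝ, E) p).symm x) := by
    simpa only [Finset.sum_apply] using MDifferentiableAt.sum_section (s := Finset.univ)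
      fun i _ ↦ (hf i).mdifferentiableAt.smul_section (hcf i)
  rw [cov.isCovariantDerivativeOnUniv.congr_of_eventuallyEq hσ hd
    Filter.univ_mem (((trivializationAt E (TangentSpace 𝓘(ℝ, E) : M → Type _)
      p).open_baseSet.eventually_mem hq).mono hsum),
    CovariantDerivative.sum_smul (fun i ↦ (hf i).mdifferentiableAt) hcf,
    ← mfderiv_coordField p hx hs]
  simp only [sum_apply, map_sum, add_apply, map_add, smul_apply, map_smul,
    ContinuousLinearMap.smulRight_apply, ← christoffel_apply, Finset.sum_add_distrib]
  have hdf (i) (U : TangentSpace 𝓘(ℝ, E) ((extChartAt 𝓘(ℝ, E) p).symm x)) :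
      mvfderiv 𝓘(ℝ, E) (fun q ↦ c i (s q)) ((extChartAt 𝓘(ℝ, E) p).symm x) U =
      c i (mfderiv 𝓘(ℝ, E) 𝓘(ℝ, E) s ((extChartAt 𝓘(ℝ, E) p).symm x) U) := by
    rw [mvfderiv, (hf i).mfderiv]
    rfl
  have hcoord (v : E) : (trivializationAt E (TangentSpace 𝓘(ℝ, E) : M → Type _)
      p).continuousLinearMapAt ℝ ((extChartAt 𝓘(ℝ, E) p).symm x)
      (coordField p v ((extChartAt 𝓘(ℝ, E) p).symm x)) = v :=
    Trivialization.continuousLinearMapAt_symmL _ hq v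
  have hb (v : E) : ∑ i, c i v • b i = v := b.sum_repr v
  simp only [hdf, hcoord]
  rw [add_comm]
  congr 1
  · exact hb _
  · refine Eq.trans ?_ (congrArg (christoffel cov p x u)
      (hb (s ((extChartAt 𝓘(ℝ, E) p).symm x))))
    simp only [map_sum, map_smul]

end Christoffel

/-! ### Induced charts of the cotangent bundle and the metric in them -/

section CotangentCharts

variable {E : Type*} [NormedAddCommGroup E] [NormedSpace ℝ E]
  {M : Type*} [TopologicalSpace M] [ChartedSpace E M] [IsManifold 𝓘(ℝ, E) ∞ M]

/-- The fibre coordinates are the values of the covector on the coordinate frame, that is, the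
`u_{i'}`. -/
theorem extChartAt_cotangent_apply (ξ η : Cotangent E M) :
    extChartAt (cotangentModel E) ξ η = (extChartAt 𝓘(ℝ, E) ξ.proj η.proj,
      η.snd.comp ((trivializationAt E (TangentSpace 𝓘(ℝ, E) : M → Type _) ξ.proj).symmL ℝ
        η.proj)) := by
  rw [FiberBundle.extChartAt]
  change ((extChartAt 𝓘(ℝ, E) ξ.proj).prod (PartialEquiv.refl (E →L[ℝ] ℝ)))
    (trivializationAt (E →L[ℝ] ℝ)
      (fun p : M ↦ TangentSpace 𝓘(ℝ, E) p →L[ℝ] Trivial M ℝ p) ξ.proj η) = _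
  rw [hom_trivializationAt_apply, ContinuousLinearMap.inCoordinates]
  refine Prod.ext rfl (ContinuousLinearMap.ext fun v ↦ ?_)
  exact DFunLike.congr_fun (Trivial.continuousLinearMapAt_trivialization ℝ M ℝ η.proj) _

theorem extChartAt_cotangent_target (ξ : Cotangent E M) :
    (extChartAt (cotangentModel E) ξ).target =
      (extChartAt 𝓘(ℝ, E) ξ.proj).target ×ˢ Set.univ := by
  rw [FiberBundle.extChartAt_target, hom_trivializationAt_baseSet]
  congr 1
  refine Set.inter_eq_left.2 fun x hx ↦ ⟨extChartAt_symm_mem_baseSet hx, Set.mem_univ _⟩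

theorem extChartAt_cotangent_symm_apply (ξ : Cotangent E M) {y : E × (E →L[ℝ] ℝ)}
    (hy : y.1 ∈ (extChartAt 𝓘(ℝ, E) ξ.proj).target) :
    (extChartAt (cotangentModel E) ξ).symm y = ⟨(extChartAt 𝓘(ℝ, E) ξ.proj).symm y.1,
      y.2.comp ((trivializationAt E (TangentSpace 𝓘(ℝ, E) : M → Type _)
        ξ.proj).continuousLinearMapAt ℝ ((extChartAt 𝓘(ℝ, E) ξ.proj).symm y.1))⟩ := by
  have hy' : y ∈ (extChartAt (cotangentModel E) ξ).target := by
    rw [extChartAt_cotangent_target]; exact ⟨hy, Set.mem_univ _⟩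
  rw [eq_comm, PartialEquiv.eq_symm_apply _ _ hy']
  · rw [extChartAt_cotangent_apply]
    refine Prod.ext ((extChartAt 𝓘(ℝ, E) ξ.proj).right_inv hy) (ContinuousLinearMap.ext fun v ↦ ?_)
    exact congrArg y.2 (Trivialization.continuousLinearMapAt_symmL _ (extChartAt_symm_mem_baseSet hy) v)
  · rw [FiberBundle.extChartAt]
    have h := (extChartAt 𝓘(ℝ, E) ξ.proj).map_target hy
    rw [extChartAt_source] at h
    simpa using ⟨h, h⟩


/-- The coordinate frame of the chart at `p`, at the point `q`, as a map `E → T_qM = E`. -/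
def frame (p q : M) : E →L[ℝ] E :=
  (trivializationAt E (TangentSpace 𝓘(ℝ, E) : M → Type _) p).symmL ℝ q

/-- The transition function of the tangent bundle from components in the chart at `q` to
components in the chart at `p`, as a function of the coordinates in the chart at `p`. -/
def frameChange (p q : M) (x : E) : E →L[ℝ] E :=
  ((trivializationAt E (TangentSpace 𝓘(ℝ, E) : M → Type _) p).continuousLinearMapAt ℝ
    ((extChartAt 𝓘(ℝ, E) p).symm x)).comp
    ((trivializationAt E (TangentSpace 𝓘(ℝ, E) : M → Type _) q).symmL ℝ
      ((extChartAt 𝓘(ℝ, E) p).symm x))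

theorem frameChange_apply (p q : M) (x v : E) :
    frameChange p q x v =
      (trivializationAt E (TangentSpace 𝓘(ℝ, E) : M → Type _) p).continuousLinearMapAt ℝ
        ((extChartAt 𝓘(ℝ, E) p).symm x) (coordField q v ((extChartAt 𝓘(ℝ, E) p).symm x)) := rfl

theorem differentiableAt_frameChange [FiniteDimensional ℝ E] {p q : M} {x : E}
    (hx : x ∈ (extChartAt 𝓘(ℝ, E) p).target)
    (hq : (extChartAt 𝓘(ℝ, E) p).symm x ∈
      (trivializationAt E (TangentSpace 𝓘(ℝ, E) : M → Type _) q).baseSet) :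
    DifferentiableAt ℝ (frameChange p q) x := by
  refine ContDiffAt.differentiableAt (n := ∞) ?_ (by simp)
  rw [contDiffAt_clm_apply_iff]
  intro v
  have hp := extChartAt_symm_mem_baseSet hx
  have h2 := contMDiffAt_coordField q v hq
  rw [(trivializationAt E (TangentSpace 𝓘(ℝ, E) : M → Type _) p).contMDiffAt_section_iff hp] at h2
  have h3 : ContMDiffAt 𝓘(ℝ, E) 𝓘(ℝ, E) ∞ (extChartAt 𝓘(ℝ, E) p).symm x :=
    (contMDiffOn_extChartAt_symm p).contMDiffAt ((isOpen_extChartAt_target p).mem_nhds hx)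
  refine (h2.comp x h3).contDiffAt.congr_of_eventuallyEq ?_
  filter_upwards [h3.continuousAt.eventually ((trivializationAt E
    (TangentSpace 𝓘(ℝ, E) : M → Type _) p).open_baseSet.eventually_mem hp)] with y hy
  exact continuousLinearMapAt_eq_snd p hy _

theorem coordField_self (q : M) (v : E) : coordField q v q = v := by
  rw [coordField, TangentBundle.symmL_trivializationAt_eq_core (mem_chart_source E q)]
  exact tangentCoordChange_self (I := 𝓘(ℝ, E)) (mem_extChartAt_source q)

theorem frameChange_symm_apply (p : M) (x v : E) :
    frameChange p ((extChartAt 𝓘(ℝ, E) p).symm x) x v =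
      (trivializationAt E (TangentSpace 𝓘(ℝ, E) : M → Type _) p).continuousLinearMapAt ℝ
        ((extChartAt 𝓘(ℝ, E) p).symm x) v := by
  rw [frameChange_apply, coordField_self]

theorem frameChange_frame {p q : M} {x : E} (hx : x ∈ (extChartAt 𝓘(ℝ, E) p).target)
    (hq : (extChartAt 𝓘(ℝ, E) p).symm x = q) (v : E) : frameChange p q x (frame p q v) = v := by
  subst hq
  rw [frameChange_symm_apply]
  exact Trivialization.continuousLinearMapAt_symmL _ (extChartAt_symm_mem_baseSet hx) v

theorem continuousLinearMapAt_self (q : M) (v : TangentSpace 𝓘(ℝ, E) q) :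
    (trivializationAt E (TangentSpace 𝓘(ℝ, E) : M → Type _) q).continuousLinearMapAt ℝ q v =
      v := by
  rw [TangentBundle.continuousLinearMapAt_trivializationAt_eq_core (mem_chart_source E q)]
  exact tangentCoordChange_self (I := 𝓘(ℝ, E)) (mem_extChartAt_source q)

theorem hasFDerivAt_chartChange {p q : M} {x : E} (hx : x ∈ (extChartAt 𝓘(ℝ, E) p).target)
    (hq : (extChartAt 𝓘(ℝ, E) p).symm x = q) :
    HasFDerivAt (fun z ↦ extChartAt 𝓘(ℝ, E) q ((extChartAt 𝓘(ℝ, E) p).symm z))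
      (frame p q) x := by
  subst hq
  have hs := (extChartAt 𝓘(ℝ, E) p).map_target hx
  have h := hasFDerivWithinAt_tangentCoordChange (I := 𝓘(ℝ, E)) ⟨hs, mem_extChartAt_source _⟩
  rw [(extChartAt 𝓘(ℝ, E) p).right_inv hx, modelWithCornersSelf_coe, Set.range_id,
    hasFDerivWithinAt_univ] at h
  rw [frame, TangentBundle.symmL_trivializationAt_eq_core (extChartAt_symm_mem_baseSet hx)]
  exact h

variable [FiniteDimensional ℝ E]

theorem christoffel_extChartAt_self
    (cov : CovariantDerivative 𝓘(ℝ, E) E (TangentSpace 𝓘(ℝ, E) : M → Type _)) (q : M) (u v : E) :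
    christoffel cov q (extChartAt 𝓘(ℝ, E) q q) u v = cov (coordField q v) q u := by
  -- The chart returns `q` only up to a propositional equality on which the tangent space depends,
  -- hence the generalisation to `q'`.
  have h (q' : M) (hq' : q' = q) : (trivializationAt E (TangentSpace 𝓘(ℝ, E) : M → Type _)
      q).continuousLinearMapAt ℝ q' (cov (coordField q v) q' (coordField q u q')) =
      cov (coordField q v) q u := by
    subst hq'
    rw [continuousLinearMapAt_self, coordField_self]
  exact h _ (extChartAt_to_inv q)

/-- The transformation law of Christoffel symbols: both sides are the covariant derivative of a
coordinate field of the chart at `q`, read in the chart at `p`. -/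
theorem frameChange_christoffel
    (cov : CovariantDerivative 𝓘(ℝ, E) E (TangentSpace 𝓘(ℝ, E) : M → Type _))
    {p q : M} {x : E} (hx : x ∈ (extChartAt 𝓘(ℝ, E) p).target)
    (hq : (extChartAt 𝓘(ℝ, E) p).symm x = q) (u w : E) :
    frameChange p q x (christoffel cov q (extChartAt 𝓘(ℝ, E) q q)
      (frame p q u) w) =
    fderiv ℝ (frameChange p q) x u w + christoffel cov p x u (frameChange p q x w) := by
  subst hq
  have hb := FiberBundle.mem_baseSet_trivializationAt' (F := E) (E := (TangentSpace 𝓘(ℝ, E)))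
    ((extChartAt 𝓘(ℝ, E) p).symm x)
  rw [christoffel_extChartAt_self, ← fderiv_clm_apply_const (differentiableAt_frameChange hx hb)]
  have h := continuousLinearMapAt_cov (cov := cov) p hx (mdifferentiableAt_coordField _ w hb) u
  refine Eq.trans ?_ h
  exact frameChange_symm_apply _ _ _

/-- The differential of the change of induced charts on the cotangent bundle. -/
theorem fderiv_cotangent_chartChange (ξ : Cotangent E M) {y : E × (E →L[ℝ] ℝ)}
    (hy : y.1 ∈ (extChartAt 𝓘(ℝ, E) ξ.proj).target) {η : Cotangent E M}
    (hη : (extChartAt (cotangentModel E) ξ).symm y = η) (U : E × (E →L[ℝ] ℝ)) :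
    (trivializationAt (E × (E →L[ℝ] ℝ)) (TangentSpace (cotangentModel E) : Cotangent E M → Type _)
      ξ).symmL ℝ η U =
    (frame ξ.proj η.proj U.1, U.2.comp (frameChange ξ.proj η.proj y.1) +
        y.2.comp (fderiv ℝ (frameChange ξ.proj η.proj) y.1 U.1)) := by
  have hp : (extChartAt 𝓘(ℝ, E) ξ.proj).symm y.1 = η.proj := by
    rw [← hη, extChartAt_cotangent_symm_apply ξ hy]
  have hyt : y ∈ (extChartAt (cotangentModel E) ξ).target := by
    rw [extChartAt_cotangent_target]; exact ⟨hy, Set.mem_univ _⟩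
  have hηs : η ∈ (extChartAt (cotangentModel E) ξ).source := by
    rw [← hη]; exact (extChartAt (cotangentModel E) ξ).map_target hyt
  have h1 : extChartAt (cotangentModel E) ξ η = y := by
    rw [← hη]; exact (extChartAt (cotangentModel E) ξ).right_inv hyt
  rw [TangentBundle.symmL_trivializationAt_eq_core (by rwa [extChartAt_source] at hηs),
    tangentBundleCore_coordChange_achart, h1, ModelWithCorners.range_eq_univ, fderivWithin_univ]
  have h2 := hasFDerivAt_chartChange hy hp
  have h3 := (differentiableAt_frameChange (q := η.proj) hy (by
    rw [hp]; exact FiberBundle.mem_baseSet_trivializationAt' _)).hasFDerivAt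
  -- The chart change is `(x, ζ) ↦ (φ(x), ζ ∘ B(x))` with `B` the frame change; the product rule
  -- produces the term `ζ ∘ B'(x)u`.
  have h4 := (h2.comp y hasFDerivAt_fst).prodMk
    ((hasFDerivAt_snd (𝕜 := ℝ) (p := y)).clm_comp (h3.comp y hasFDerivAt_fst))
  have h5 : (extChartAt (cotangentModel E) η ∘ (extChartAt (cotangentModel E) ξ).symm) =ᶠ[𝓝 y]
      fun z ↦ (extChartAt 𝓘(ℝ, E) η.proj ((extChartAt 𝓘(ℝ, E) ξ.proj).symm z.1),
        z.2.comp (frameChange ξ.proj η.proj z.1)) := by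
    filter_upwards [continuousAt_fst.eventually
      ((isOpen_extChartAt_target ξ.proj).eventually_mem hy)] with z hz
    rw [Function.comp_apply, extChartAt_cotangent_symm_apply ξ hz, extChartAt_cotangent_apply]
    rfl
  rw [(h4.congr_of_eventuallyEq h5).fderiv]
  refine Prod.ext rfl ?_
  exact add_comm (y.2.comp (fderiv ℝ (frameChange ξ.proj η.proj) y.1 U.1))
    (U.2.comp (frameChange ξ.proj η.proj y.1))

/-- Here `J` is the frame, `B` its inverse and `D` the derivative of `B`. The law `hΓ`, used at `(U,
JV)` and `(V, JU)`, expresses `2ζ(B(Γ'(JU,JV)))` as `2ζ(Γ(U,V))` plus the two `D` terms coming from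
the covector components, which then cancel. -/
theorem riemannExtForm_chartChange {Γ Γ' : E →L[ℝ] E →L[ℝ] E} {J B : E →L[ℝ] E}
    {D : E →L[ℝ] E →L[ℝ] E} (hBJ : ∀ v, B (J v) = v)
    (hΓ : ∀ u v, B (Γ' (J u) v) = D u v + Γ u (B v)) (hs : ∀ u v, Γ u v = Γ v u)
    (hs' : ∀ u v, Γ' u v = Γ' v u) (ζ : E →L[ℝ] ℝ) (U V : E × (E →L[ℝ] ℝ)) :
    riemannExtForm Γ' (ζ.comp B) (J U.1, U.2.comp B + ζ.comp (D U.1))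
      (J V.1, V.2.comp B + ζ.comp (D V.1)) = riemannExtForm Γ ζ U V := by
  have h1 := congrArg ζ (hΓ U.1 (J V.1))
  have h2 := congrArg ζ (hΓ V.1 (J U.1))
  rw [hs' (J V.1), hBJ, map_add] at h2
  rw [hBJ, map_add] at h1
  change _ = U.2 V.1 + V.2 U.1 - 2 * ζ (Γ U.1 V.1)
  rw [riemannExtForm_apply]
  simp only [add_apply, ContinuousLinearMap.comp_apply, hBJ]
  rw [hs V.1] at h2
  linarith

omit [FiniteDimensional ℝ E] in
theorem snd_eq_comp_frameChange {ξ : Cotangent E M} {y : E × (E →L[ℝ] ℝ)}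
    (hy : y.1 ∈ (extChartAt 𝓘(ℝ, E) ξ.proj).target) {η : Cotangent E M}
    (hη : (extChartAt (cotangentModel E) ξ).symm y = η) :
    η.snd = y.2.comp (frameChange ξ.proj η.proj y.1) := by
  rw [extChartAt_cotangent_symm_apply ξ hy] at hη
  subst hη
  exact ContinuousLinearMap.ext fun v ↦
    congrArg y.2 (frameChange_symm_apply ξ.proj y.1 v).symm

/-- The Riemannian extension has its defining form in all induced coordinates. -/
theorem metricInChart_riemannExt
    {cov : CovariantDerivative 𝓘(ℝ, E) E (TangentSpace 𝓘(ℝ, E) : M → Type _)}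
    (htors : cov.torsion = 0) (ξ : Cotangent E M) {y : E × (E →L[ℝ] ℝ)}
    (hy : y.1 ∈ (extChartAt 𝓘(ℝ, E) ξ.proj).target) :
    metricInChart (riemannExt cov) ξ y = extensionMetric (christoffel cov ξ.proj) y := by
  refine ContinuousLinearMap.ext fun U ↦ ContinuousLinearMap.ext fun V ↦ ?_
  rw [metricInChart_apply, extensionMetric]
  set η := (extChartAt (cotangentModel E) ξ).symm y with hηdef
  have hp : (extChartAt 𝓘(ℝ, E) ξ.proj).symm y.1 = η.proj := by
    rw [hηdef, extChartAt_cotangent_symm_apply ξ hy]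
  rw [fderiv_cotangent_chartChange ξ hy hηdef.symm, fderiv_cotangent_chartChange ξ hy hηdef.symm]
  have hsnd : η.snd = y.2.comp (frameChange ξ.proj η.proj y.1) :=
    snd_eq_comp_frameChange hy hηdef.symm
  have h := riemannExtForm_chartChange (frameChange_frame hy hp)
    (frameChange_christoffel cov hy hp) (christoffel_symm htors ξ.proj hy)
    (christoffel_symm htors η.proj (mem_extChartAt_target _)) y.2 U V
  rw [← h, ← hsnd]
  rfl

end CotangentCharts

/-! ### Comparison of the two Szabó operators on the manifold -/

section Main

variable {E : Type*} [NormedAddCommGroup E] [NormedSpace ℝ E] [FiniteDimensional ℝ E]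
  {M : Type*} [TopologicalSpace M] [ChartedSpace E M] [IsManifold 𝓘(ℝ, E) ∞ M]

omit [FiniteDimensional ℝ E] in
theorem mfderiv_cotangent_proj (ξ : Cotangent E M) (U : E × (E →L[ℝ] ℝ)) :
    mfderiv (cotangentModel E) 𝓘(ℝ, E) (fun η : Cotangent E M ↦ η.proj) ξ U = U.1 := by
  have hd : MDifferentiableAt (cotangentModel E) 𝓘(ℝ, E) (fun η : Cotangent E M ↦ η.proj) ξ :=
    (contMDiffAt_proj (n := 1) _).mdifferentiableAt one_ne_zero
  rw [hd.mfderiv, ModelWithCorners.range_eq_univ, fderivWithin_univ]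
  have hξ : (extChartAt (cotangentModel E) ξ ξ).1 ∈ (extChartAt 𝓘(ℝ, E) ξ.proj).target := by
    rw [extChartAt_cotangent_apply]; exact mem_extChartAt_target _
  have h : writtenInExtChartAt (cotangentModel E) 𝓘(ℝ, E) ξ (fun η : Cotangent E M ↦ η.proj)
      =ᶠ[𝓝 (extChartAt (cotangentModel E) ξ ξ)] Prod.fst := by
    filter_upwards [continuousAt_fst.eventually
      ((isOpen_extChartAt_target ξ.proj).eventually_mem hξ)] with z hz
    rw [writtenInExtChartAt, Function.comp_apply, Function.comp_apply,
      extChartAt_cotangent_symm_apply ξ hz]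
    exact (extChartAt 𝓘(ℝ, E) ξ.proj).right_inv hz
  rw [h.fderiv_eq, fderiv_fst]
  rfl

theorem metricSzabo_riemannExt
    {cov : CovariantDerivative 𝓘(ℝ, E) E (TangentSpace 𝓘(ℝ, E) : M → Type _)}
    (htors : cov.torsion = 0) (ξ : Cotangent E M) (X : E × (E →L[ℝ] ℝ)) :
    metricSzabo (riemannExt cov) ξ X =
      (localSzabo (localLeviCivita (extensionMetric (christoffel cov ξ.proj)))
        (extChartAt (cotangentModel E) ξ ξ) X).toLinearMap := by
  have hξ : (extChartAt (cotangentModel E) ξ ξ).1 ∈ (extChartAt 𝓘(ℝ, E) ξ.proj).target := by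
    rw [extChartAt_cotangent_apply]; exact mem_extChartAt_target _
  have h : metricInChart (riemannExt cov) ξ =ᶠ[𝓝 (extChartAt (cotangentModel E) ξ ξ)]
      extensionMetric (christoffel cov ξ.proj) := by
    filter_upwards [continuousAt_fst.eventually
      ((isOpen_extChartAt_target ξ.proj).eventually_mem hξ)] with z hz
    exact metricInChart_riemannExt htors ξ hz
  -- Equality of the metrics near the point gives equality of the Levi-Civita symbols at every
  -- nearby point, as required for the Szabó operator.
  exact congrArg ContinuousLinearMap.toLinearMap (localSzabo_congr
    (h.eventuallyEq_nhds.mono fun z hz ↦ localLeviCivita_congr hz) X)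

/-- The Szabó operator of the Riemannian extension has the same real and complex spectrum as the
affine Szabó operator. -/
theorem spectrum_metricSzabo_riemannExt [T2Space M]
    {cov : CovariantDerivative 𝓘(ℝ, E) E (TangentSpace 𝓘(ℝ, E) : M → Type _)}
    (hcov : CovariantDerivative.ContMDiffCovariantDerivative cov ∞) (htors : cov.torsion = 0)
    (ξ : Cotangent E M) (X : E × (E →L[ℝ] ℝ)) :
    spectrum ℝ (metricSzabo (riemannExt cov) ξ X) = spectrum ℝ (affineSzabo cov ξ.proj X.1) ∧
    spectrum ℂ ((metricSzabo (riemannExt cov) ξ X).baseChange ℂ) =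
      spectrum ℂ ((affineSzabo cov ξ.proj X.1).baseChange ℂ) := by
  have hξ : (extChartAt (cotangentModel E) ξ ξ).1 = extChartAt 𝓘(ℝ, E) ξ.proj ξ.proj := by
    rw [extChartAt_cotangent_apply]
  have ht : ∀ᶠ x in 𝓝 (extChartAt (cotangentModel E) ξ ξ).1,
      x ∈ (extChartAt 𝓘(ℝ, E) ξ.proj).target := by
    rw [hξ]; exact (isOpen_extChartAt_target ξ.proj).eventually_mem (mem_extChartAt_target _)
  have hs := ht.mono fun x hx ↦ contDiffAt_christoffel hcov ξ.proj hx
  have hsymm := ht.mono fun x hx ↦ christoffel_symm htors ξ.proj hx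
  have h := spectrum_eq_of_transpose (fst_localSzabo_extensionMetric hs X)
    (localSzabo_extensionMetric_vertical hs hsymm X)
  rw [hξ] at h
  rw [metricSzabo_riemannExt htors]
  exact h

end Main

end SzaboExtension

end

theorem mainTheorem8 (n : ℕ) {M : Type*} [TopologicalSpace M] [T2Space M]
    [ChartedSpace (EuclideanSpace ℝ (Fin n)) M] [IsManifold (𝓡 n) ∞ M]
    (cov : CovariantDerivative (𝓡 n) (EuclideanSpace ℝ (Fin n))
      (TangentSpace (𝓡 n) : M → Type _))
    (hsmooth : CovariantDerivative.ContMDiffCovariantDerivative cov ∞)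
    (htorsion : cov.torsion = 0)
    (ξ : SzaboExtension.Cotangent (EuclideanSpace ℝ (Fin n)) M)
    (Xtilde : TangentSpace (SzaboExtension.cotangentModel (EuclideanSpace ℝ (Fin n))) ξ)
    (X : TangentSpace (𝓡 n) ξ.proj)
    (hX : X = mfderiv (SzaboExtension.cotangentModel (EuclideanSpace ℝ (Fin n))) (𝓡 n)
      (fun η : SzaboExtension.Cotangent (EuclideanSpace ℝ (Fin n)) M ↦ η.proj) ξ Xtilde) :
    spectrum ℝ (SzaboExtension.metricSzabo (SzaboExtension.riemannExt cov) ξ Xtilde) =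
      spectrum ℝ (SzaboExtension.affineSzabo cov ξ.proj X) ∧
    spectrum ℂ ((SzaboExtension.metricSzabo (SzaboExtension.riemannExt cov) ξ Xtilde).baseChange
        ℂ) =
      spectrum ℂ ((SzaboExtension.affineSzabo cov ξ.proj X).baseChange ℂ) := by
  -- In the induced chart at `ξ` the tangent space is `E × E*` and the differential of the
  -- projection is the first component.
  obtain rfl : X = Xtilde.1 := hX.trans (SzaboExtension.mfderiv_cotangent_proj ξ Xtilde)
  exact SzaboExtension.spectrum_metricSzabo_riemannExt hsmooth htorsion ξ Xtilde
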